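/- Let $k$ be a commutative ring, let $n\ge 0$, and let $X=\mathbb A^n_{\mathtt F_1}$ be the finite topological space of all subsets of $\Delta_n=\{1,\dots,n\}$, ordered by inclusion, whose open sets are the upper sets; let $\mathbf 1=\Delta_n$ be its open point. Let $D(X)$ be the derived category of complexes of sheaves of $k$-modules on $X$. Let $\omega=k_{\{\mathbf 1\}}$ be the constant sheaf $k$ supported on $\{\mathbf 1\}$ (stalk $k$ at $\mathbf 1$ and $0$ elsewhere), and put $D(F)=\mathbb R\mathcal Hom_X(F,\omega)$ for $F\in D(X)$, with the natural (evaluation) morphism $F\to D(D(F))$. A complex $F\in D(X)$ is called pointwise perfect if for every $p\in X$ the stalk $F_p$ is a perfect complex of $k$-modules, i.e. quasi-isomorphic to a bounded complex of finitely generated projective modules. Then: (a) If $F\in D(X)$ is pointwise perfect, then $D(F)$ is pointwise perfect and the natural morphism $F\to D(D(F))$ is an isomorphism in $D(X)$. (b) Assume that $k$ is Gorenstein (i.e. $k$ is noetherian and for every prime ideal $\mathfrak p$ the local ring $k_{\mathfrak p}$ has finite injective dimension over itself) and has finite Krull dimension. If $F\in D(X)$ has finitely generated cohomology sheaves, i.e.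 $H^i(F)_p$ is a finitely generated $k$-module for all $i\in\mathbb Z$ and $p\in X$, then $D(F)$ also has finitely generated cohomology sheaves and the natural morphism $F\to D(D(F))$ is an isomorphism in $D(X)$. -/

import Mathlib

open CategoryTheory Limits CochainComplex.HomComplex

universe u w

noncomputable section

namespace F1

/-! ### Sheaves of modules on a finite poset -/

/-- Sheaves of `k`-modules on a finite `T₀`-space `X`, i.e. on a finite poset whose open subsets are
the upper sets. A sheaf is given by its stalks `F_p = Γ(U_p, F)`, where `U_p = {q | p ≤ q}` is the
smallest open neighbourhood of `p`, and by the restriction maps `F_p ⟶ F_q` for `p ≤ q`, i.e. by a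
functor from `X` to `k`-modules; see `Shv.equivTopSheaf` for the comparison. -/
abbrev Shv (k : Type u) [CommRing k] (X : Type) [PartialOrder X] : Type (u + 1) :=
  X ⥤ ModuleCat.{u} k

section Comparison

variable (X : Type) [PartialOrder X]

open TopologicalSpace in
/-- The contravariant functor `p ↦ U_p` from `X` to the open subsets of the topological
space `X`, whose opens are the upper sets. -/
def principal : Xᵒᵖ ⥤ Opens (TopCat.of (Topology.WithUpperSet X)) where
  obj p := ⟨{q | p.unop ≤ Topology.WithUpperSet.ofUpperSet q},
    (Topology.IsUpperSet.isOpen_iff_isUpperSet).2 fun _ _ h h' => le_trans h' h⟩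
  map f := homOfLE fun _ h => le_trans f.unop.le h

lemma mem_principal_self (p : Xᵒᵖ) :
    Topology.WithUpperSet.toUpperSet p.unop ∈ (principal X).obj p := le_refl p.unop

lemma principal_le {p : Xᵒᵖ} {U : TopologicalSpace.Opens (TopCat.of (Topology.WithUpperSet X))}
    (h : Topology.WithUpperSet.toUpperSet p.unop ∈ U) : (principal X).obj p ≤ U :=
  fun _ hq => (Topology.IsUpperSet.isOpen_iff_isUpperSet).1 U.isOpen hq h

instance : (principal X).Full where
  map_surjective {p q} f := ⟨(homOfLE (f.le (mem_principal_self X p) : q.unop ≤ p.unop)).op, rfl⟩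

instance : (principal X).Faithful where
  map_injective _ := Subsingleton.elim _ _

instance : (principal X).IsCoverDense
    (Opens.grothendieckTopology (TopCat.of (Topology.WithUpperSet X))) where
  is_cover _ x hx :=
    let p : Xᵒᵖ := Opposite.op (Topology.WithUpperSet.ofUpperSet x)
    ⟨(principal X).obj p, homOfLE (principal_le X hx), ⟨⟨p, 𝟙 _, homOfLE (principal_le X hx), rfl⟩⟩,
      mem_principal_self X p⟩

instance : (principal X).IsDenseSubsite (⊥ : GrothendieckTopology Xᵒᵖ)
    (Opens.grothendieckTopology (TopCat.of (Topology.WithUpperSet X))) where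
  functorPushforward_mem_iff {p S} := by
    rw [GrothendieckTopology.bot_covering]
    constructor
    · intro h
      obtain ⟨U, f, ⟨q, g, a, hg, -⟩, hU⟩ := h _ (mem_principal_self X p)
      have hle : q.unop ≤ p.unop := a.le hU
      have : S (g.op.unop) := hg
      rw [← Sieve.id_mem_iff_eq_top]
      have e := S.downward_closed hg (homOfLE hle).op
      rwa [Subsingleton.elim ((homOfLE hle).op ≫ g) (𝟙 p)] at e
    · rintro rfl
      rw [Sieve.functorPushforward_top]
      exact GrothendieckTopology.top_mem _ _

/-- Functors `X ⥤ ModuleCat k` are the same as sheaves of `k`-modules on the topological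
space `X`. -/
def Shv.equivTopSheaf (k : Type u) [CommRing k] :
    Shv k X ≌ TopCat.Sheaf (ModuleCat.{u} k) (TopCat.of (Topology.WithUpperSet X)) :=
  ((opOpEquivalence X).congrLeft (E := ModuleCat.{u} k)).symm.trans <|
    (sheafBotEquivalence (ModuleCat.{u} k)).symm.trans <|
      Functor.IsDenseSubsite.sheafEquiv ⊥
        (Opens.grothendieckTopology (TopCat.of (Topology.WithUpperSet X))) (principal X)
        (ModuleCat.{u} k)

/-- Under this equivalence, the value of the functor at `p` is the stalk `Γ(U_p, F)`. -/
lemma Shv.equivTopSheaf_inverse_obj_obj (k : Type u) [CommRing k]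
    (F : TopCat.Sheaf (ModuleCat.{u} k) (TopCat.of (Topology.WithUpperSet X))) (p : X) :
    ((Shv.equivTopSheaf X k).inverse.obj F).obj p =
      F.presheaf.obj (Opposite.op ((principal X).obj (Opposite.op p))) := rfl

end Comparison

variable {k : Type u} [CommRing k] {X : Type} [PartialOrder X]

/-- There are enough injective sheaves, so that injective resolutions exist. -/
instance : EnoughInjectives (Shv k X) where
  presentation F := by
    let J (p : X) : Shv k X :=
      (evaluationRightAdjoint (ModuleCat.{u} k) p).obj (Injective.under (F.obj p))
    have (p : X) : Injective (J p) :=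
      (evaluationAdjunctionLeft (ModuleCat.{u} k) p).map_injective _ inferInstance
    let f (p : X) : F ⟶ J p :=
      (evaluationAdjunctionLeft (ModuleCat.{u} k) p).homEquiv _ _ (Injective.ι (F.obj p))
    have hf : Mono (Pi.lift f) := by
      have (p : X) : Mono ((Pi.lift f).app p) := by
        have h : (Pi.lift f).app p ≫ (Pi.π J p).app p = (f p).app p := by
          rw [← NatTrans.comp_app, Pi.lift_π]
        have h' : (f p).app p ≫ Pi.π (fun _ : p ⟶ p => Injective.under (F.obj p)) (𝟙 p) =
            Injective.ι (F.obj p) :=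
          ((evaluationAdjunctionLeft (ModuleCat.{u} k) p).homEquiv _ _).symm_apply_apply _
        have : Mono ((f p).app p) := by
          have : Mono ((f p).app p ≫ Pi.π (fun _ : p ⟶ p => Injective.under (F.obj p)) (𝟙 p)) := by
            rw [h']; infer_instance
          exact mono_of_mono _ (Pi.π (fun _ : p ⟶ p => Injective.under (F.obj p)) (𝟙 p))
        rw [← h] at this
        exact mono_of_mono _ ((Pi.π J p).app p)
      exact NatTrans.mono_of_mono_app _
    exact ⟨⟨∏ᶜ J, inferInstance, Pi.lift f, hf⟩⟩

/-! ### The complex of sheaves of homomorphisms -/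

/-- The inclusion `U_q ⊆ U_p` for `p ≤ q`. -/
def inclU {p q : X} (h : p ≤ q) : Set.Ici q ⥤ Set.Ici p :=
  Monotone.functor (f := fun x => ⟨x.1, h.trans x.2⟩) fun _ _ hxy => hxy

/-- The restriction of a complex of sheaves on `X` to the open subset `U_p`. -/
abbrev restrictU (p : X) (F : CochainComplex (Shv k X) ℤ) :
    CochainComplex (Shv k (Set.Ici p)) ℤ :=
  (((Functor.whiskeringLeft (Set.Ici p) X (ModuleCat.{u} k)).obj
    (Monotone.functor (Subtype.mono_coe _))).mapHomologicalComplex _).obj F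

/-- For `p ≤ q`, the restriction to `U_q` of a cochain of degree `m` of homomorphisms
`F|U_p ⟶ G|U_p`. -/
def restrictCochain (F G : CochainComplex (Shv k X) ℤ) {p q : X} (h : p ≤ q) (m : ℤ) :
    Cochain (restrictU p F) (restrictU p G) m →ₗ[k]
      Cochain (restrictU q F) (restrictU q G) m where
  toFun φ := Cochain.mk fun a b hab => Functor.whiskerLeft (inclU h) (φ.v a b hab)
  map_add' _ _ := rfl
  map_smul' _ _ := rfl

lemma restrictCochain_v (F G : CochainComplex (Shv k X) ℤ) {p q : X} (h : p ≤ q) (m : ℤ)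
    (φ : Cochain (restrictU p F) (restrictU p G) m) (a b : ℤ) (hab : a + m = b) :
    (restrictCochain F G h m φ).v a b hab = Functor.whiskerLeft (inclU h) (φ.v a b hab) := rfl

lemma δ_restrictCochain (F G : CochainComplex (Shv k X) ℤ) {p q : X} (h : p ≤ q) (m m' : ℤ)
    (φ : Cochain (restrictU p F) (restrictU p G) m) :
    δ m m' (restrictCochain F G h m φ) = restrictCochain F G h m' (δ m m' φ) := by
  by_cases hm : m + 1 = m'
  · ext a b hab : 1
    rw [restrictCochain_v, δ_v m m' hm _ a b hab _ _ rfl rfl, δ_v m m' hm _ a b hab _ _ rfl rfl]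
    rfl
  · rw [δ_shape _ _ hm, δ_shape _ _ hm, map_zero]

/-- The complex of sheaves `ℋom^•(F, G)` on `X`: its sections over `U_p` in degree `m` are the
families of homomorphisms `F^a|U_p ⟶ G^(a + m)|U_p`, `a ∈ ℤ`, and its differential is
`φ ↦ d ∘ φ - (-1)^m φ ∘ d`. -/
def sheafHom (F G : CochainComplex (Shv k X) ℤ) : CochainComplex (Shv k X) ℤ where
  X m :=
    { obj p := ModuleCat.of k (Cochain (restrictU p F) (restrictU p G) m)
      map f := ModuleCat.ofHom (restrictCochain F G f.le m)
      map_id _ := rfl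
      map_comp _ _ := rfl }
  d m m' :=
    { app p := ModuleCat.ofHom (δ_hom k (restrictU p F) (restrictU p G) m m')
      naturality p q f := by
        ext φ : 2
        exact δ_restrictCochain F G f.le m m' φ }
  shape m m' h := by
    ext p : 2
    ext φ : 2
    exact δ_shape m m' h φ
  d_comp_d' m m' m'' _ _ := by
    ext p : 2
    ext φ : 2
    exact δ_δ m m' m'' φ

/-- The linear map `F^m_q ⟶ G^b_q` induced on the stalks at a point `q` of `U_p` by a cochain `φ`
of homomorphisms `F|U_p ⟶ G|U_p`. -/
def stalkMap {F G : CochainComplex (Shv k X) ℤ} {p : X} {a : ℤ}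
    (φ : Cochain (restrictU p F) (restrictU p G) a) (m b : ℤ) (hab : m + a = b) (q : X)
    (hq : p ≤ q) : (F.X m).obj q →ₗ[k] (G.X b).obj q :=
  ((φ.v m b hab).app ⟨q, hq⟩).hom

/-- The restriction map `F_p ⟶ F_q` of a sheaf, for `p ≤ q`. -/
def res (F : Shv k X) {p q : X} (h : p ≤ q) : F.obj p →ₗ[k] F.obj q :=
  (F.map (homOfLE h)).hom

lemma res_refl (F : Shv k X) (p : X) (x : F.obj p) : res F (le_refl p) x = x :=
  congrArg (fun f => f.hom x) (F.map_id p)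

lemma res_res (F : Shv k X) {p q r : X} (h : p ≤ q) (h' : q ≤ r) (x : F.obj p) :
    res F h' (res F h x) = res F (h.trans h') x :=
  (congrArg (fun f => f.hom x) (F.map_comp (homOfLE h) (homOfLE h'))).symm

lemma res_hom {F G : Shv k X} (f : F ⟶ G) {p q : X} (h : p ≤ q) (x : F.obj p) :
    res G h ((f.app p).hom x) = (f.app q).hom (res F h x) :=
  (congrArg (fun f => f.hom x) (f.naturality (homOfLE h))).symm

lemma stalkMap_res {F G : CochainComplex (Shv k X) ℤ} {p : X} {a : ℤ}
    (φ : Cochain (restrictU p F) (restrictU p G) a) (m b : ℤ) (hab : m + a = b) {q r : X}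
    (hq : p ≤ q) (h : q ≤ r) (x : (F.X m).obj q) :
    stalkMap φ m b hab r (hq.trans h) (res (F.X m) h x) =
      res (G.X b) h (stalkMap φ m b hab q hq x) :=
  congrArg (fun f => f.hom x) ((φ.v m b hab).naturality
    (X := ⟨q, hq⟩) (Y := ⟨r, hq.trans h⟩) (homOfLE h))

lemma stalkMap_δ {F G : CochainComplex (Shv k X) ℤ} {p : X} {a a' : ℤ} (ha : a + 1 = a')
    (φ : Cochain (restrictU p F) (restrictU p G) a) (m b : ℤ) (hab : m + a' = b) (q : X)
    (hq : p ≤ q) (x : (F.X m).obj q) :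
    stalkMap (δ a a' φ) m b hab q hq x =
      ((G.d (b - 1) b).app q).hom (stalkMap φ m (b - 1) (by lia) q hq x) +
        a'.negOnePow • stalkMap φ (m + 1) b (by lia) q hq (((F.d m (m + 1)).app q).hom x) := by
  simp only [stalkMap]
  rw [δ_v a a' ha φ m b hab (b - 1) (m + 1) rfl rfl]
  rfl

/-- The evaluation at a section `x` of `F^m` over `U_p` of the homomorphisms `φ : F|U_q ⟶ G|U_q` of
degree `a`, for `p ≤ q`: it sends `φ` to the section `(-1)^(m * a) φ(x)` of `G^(a + m)` over `U_q`. -/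
def evalAt (F G : CochainComplex (Shv k X) ℤ) (m a b : ℤ) (hab : a + m = b) {p q : X} (h : p ≤ q) :
    (F.X m).obj p →ₗ[k]
      Cochain (restrictU q F) (restrictU q G) a →ₗ[k] (G.X b).obj q :=
  LinearMap.mk₂ k
    (fun x φ => (m * a).negOnePow •
      stalkMap φ m b (by lia) q (le_refl q) (res (F.X m) h x))
    (fun x y φ => by rw [map_add, map_add, smul_add])
    (fun c x φ => by rw [map_smul, map_smul, smul_comm])
    (fun x φ ψ => by rw [← smul_add]; rfl)
    (fun c x φ => by rw [smul_comm c]; rfl)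

lemma evalAt_apply (F G : CochainComplex (Shv k X) ℤ) (m a b : ℤ) (hab : a + m = b) {p q : X}
    (h : p ≤ q) (x : (F.X m).obj p) (φ : Cochain (restrictU q F) (restrictU q G) a) :
    evalAt F G m a b hab h x φ =
      (m * a).negOnePow • stalkMap φ m b (by lia) q (le_refl q) (res (F.X m) h x) := rfl

lemma evalAt_res (F G : CochainComplex (Shv k X) ℤ) (m a b : ℤ) (hab : a + m = b) {p q r : X}
    (h : p ≤ q) (h' : q ≤ r) (x : (F.X m).obj p)
    (φ : Cochain (restrictU r F) (restrictU r G) a) :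
    evalAt F G m a b hab h' (res (F.X m) h x) φ = evalAt F G m a b hab (h.trans h') x φ := by
  rw [evalAt_apply, evalAt_apply, res_res]

lemma evalAt_restrictCochain (F G : CochainComplex (Shv k X) ℤ) (m a b : ℤ) (hab : a + m = b)
    {p q r : X} (h : p ≤ q) (h' : q ≤ r) (x : (F.X m).obj p)
    (φ : Cochain (restrictU q F) (restrictU q G) a) :
    evalAt F G m a b hab (h.trans h') x (restrictCochain F G h' a φ) =
      res (G.X b) h' (evalAt F G m a b hab h x φ) := by
  rw [evalAt_apply, evalAt_apply, ← res_res _ h h']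
  simp only [Units.smul_def, map_zsmul]
  rw [← stalkMap_res φ m b (by lia) (le_refl q) h']
  rfl

lemma evalAt_δ (F G : CochainComplex (Shv k X) ℤ) (m a b : ℤ) (hab : a + (m + 1) = b) {p q : X}
    (h : p ≤ q) (x : (F.X m).obj p) (φ : Cochain (restrictU q F) (restrictU q G) a) :
    ((G.d (b - 1) b).app q).hom (evalAt F G m a (b - 1) (by lia) h x φ) +
        (m + 1).negOnePow • evalAt F G m (a + 1) b (by lia) h x (δ a (a + 1) φ) =
      evalAt F G (m + 1) a b hab h (((F.d m (m + 1)).app p).hom x) φ := by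
  simp only [evalAt_apply]
  rw [stalkMap_δ rfl, res_hom]
  have h₁ : (m + 1).negOnePow * (m * (a + 1)).negOnePow = -(m * a).negOnePow := by
    rw [← Int.negOnePow_add, ← Int.negOnePow_succ, Int.negOnePow_eq_iff]
    exact ⟨m, by ring⟩
  have h₂ : (m + 1).negOnePow * (m * (a + 1)).negOnePow * (a + 1).negOnePow =
      ((m + 1) * a).negOnePow := by
    rw [← Int.negOnePow_add, ← Int.negOnePow_add, Int.negOnePow_eq_iff]
    exact ⟨m + 1, by ring⟩
  rw [smul_add, smul_add, smul_smul, smul_smul, smul_smul, h₂, h₁]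
  simp only [Units.smul_def, map_zsmul, Units.val_neg, neg_smul]
  abel

/-- The evaluation at a section `x` of `F^m` over `U_p`, as a cochain of degree `m` of homomorphisms
`ℋom^•(F, G)|U_p ⟶ G|U_p`. -/
def evalCochain (F G : CochainComplex (Shv k X) ℤ) (m : ℤ) (p : X) :
    (F.X m).obj p →ₗ[k] Cochain (restrictU p (sheafHom F G)) (restrictU p G) m where
  toFun x := Cochain.mk fun a b hab =>
    { app q := ModuleCat.ofHom (evalAt F G m a b hab q.2 x)
      naturality q q' f := by
        ext φ
        exact evalAt_restrictCochain F G m a b hab q.2 f.le x φ }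
  map_add' x y := by
    ext a b hab q φ
    exact congrArg (fun l => l φ) (map_add (evalAt F G m a b hab q.2) x y)
  map_smul' c x := by
    ext a b hab q φ
    exact congrArg (fun l => l φ) (map_smul (evalAt F G m a b hab q.2) c x)

/-- The biduality morphism `F ⟶ ℋom^•(ℋom^•(F, G), G)`, given by evaluation:
`x ↦ (φ ↦ (-1)^(deg x * deg φ) φ(x))`. -/
def biduality (F G : CochainComplex (Shv k X) ℤ) : F ⟶ sheafHom (sheafHom F G) G where
  f m :=
    { app p := ModuleCat.ofHom (evalCochain F G m p)
      naturality p q f := by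
        ext x : 2
        change evalCochain F G m q (res (F.X m) f.le x) =
          restrictCochain _ _ f.le m (evalCochain F G m p x)
        ext a b hab r φ
        exact evalAt_res F G m a b hab f.le r.2 x φ }
  comm' m m' h := by
    obtain rfl : m + 1 = m' := h
    ext p : 2
    ext x : 2
    change δ m (m + 1) (evalCochain F G m p x) =
      evalCochain F G (m + 1) p (((F.d m (m + 1)).app p).hom x)
    ext a b hab q φ
    exact (stalkMap_δ (F := sheafHom F G) rfl (evalCochain F G m p x) a b hab q.1 q.2 φ).trans
      (evalAt_δ F G m a b hab q.2 x φ)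

/-! ### Perfect complexes and coherent complexes -/

/-- A complex of `k`-modules is perfect if it is quasi-isomorphic to a bounded complex of finitely
generated projective modules. -/
def IsPerfect (E : CochainComplex (ModuleCat.{u} k) ℤ) : Prop :=
  ∃ (P : CochainComplex (ModuleCat.{u} k) ℤ) (f : P ⟶ E),
    QuasiIso f ∧ (∃ a b : ℤ, P.IsStrictlyGE a ∧ P.IsStrictlyLE b) ∧
      ∀ i, Module.Finite k (P.X i) ∧ Module.Projective k (P.X i)

/-- The stalk `F_p` of a complex of sheaves. -/
abbrev stalk (p : X) (F : CochainComplex (Shv k X) ℤ) : CochainComplex (ModuleCat.{u} k) ℤ :=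
  (((evaluation X (ModuleCat.{u} k)).obj p).mapHomologicalComplex _).obj F

/-- Pointwise perfect complexes of sheaves, i.e. objects of `D_perf(X)`. -/
def IsPointwisePerfect (F : CochainComplex (Shv k X) ℤ) : Prop :=
  ∀ p, IsPerfect (stalk p F)

/-- Complexes of sheaves with finitely generated cohomology sheaves, i.e. objects of `D_c(X)`. -/
def HasFGCohomology (F : CochainComplex (Shv k X) ℤ) : Prop :=
  ∀ (i : ℤ) (p : X), Module.Finite k ((F.homology i).obj p)

/-- A Gorenstein ring: a noetherian ring all of whose localizations at prime ideals have finite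
injective dimension over themselves. -/
def IsGorensteinRing (R : Type u) [CommRing R] : Prop :=
  IsNoetherianRing R ∧ ∀ (p : Ideal R) [p.IsPrime], ∃ d : ℕ,
    HasInjectiveDimensionLE
      (ModuleCat.of (Localization.AtPrime p) (Localization.AtPrime p)) d

/-! ### The affine space over the field with one element and its dualizing functor -/

/-- The finite space `𝔸ⁿ`: subsets of `{1, …, n}`, ordered by inclusion. -/
abbrev Affine (n : ℕ) : Type := Finset (Fin n)

/-- The canonical sheaf `ω = k_{𝟏}` of `𝔸ⁿ`: the constant sheaf `k` supported on the open point
`𝟏 = {1, …, n}`, as a subsheaf of the constant sheaf `k`. -/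
def omega (k : Type u) [CommRing k] (n : ℕ) : Shv k (Affine n) where
  obj p := ModuleCat.of k (if p = Finset.univ then ⊤ else ⊥ : Submodule k k)
  map {p q} f := ModuleCat.ofHom <| Submodule.inclusion <| by
    have h : p ⊆ q := f.le
    split_ifs with hp hq
    · exact le_rfl
    · exact (hq (Finset.univ_subset_iff.1 (hp ▸ h))).elim
    · exact bot_le
    · exact le_rfl
  map_id _ := rfl
  map_comp _ _ := rfl

/-- The complex `D(F) = ℝℋom(F, ω) = ℋom^•(F, I)`, computed with an injective resolution `I`
of `ω`. -/
abbrev dual {n : ℕ} (I : InjectiveResolution (omega k n))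
    (F : CochainComplex (Shv k (Affine n)) ℤ) : CochainComplex (Shv k (Affine n)) ℤ :=
  sheafHom F I.cochainComplex

/-- The natural morphism `F ⟶ D(D(F))`. -/
abbrev toBidual {n : ℕ} (I : InjectiveResolution (omega k n))
    (F : CochainComplex (Shv k (Affine n)) ℤ) : F ⟶ dual I (dual I F) :=
  biduality F I.cochainComplex

end F1

end

/-!
A sheaf on `𝔸ⁿ` is a functor on the poset of subsets of `{1, …, n}`. A sheaf is called free on
`U_q = {s | q ⊆ s}` if it is constant on `U_q` and zero elsewhere; if its stalk at `q` is `E`, its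
morphisms to `F` are the homomorphisms `E ⟶ F_q`. Everything is reduced to complexes of such
sheaves, for which duality is duality of modules.

*Free sheaves.* Two basic open sets satisfy `U_p ∩ U_q = U_{p ∪ q}`. Hence, if `F` is free on
`U_q`, evaluation at `p ∪ q` identifies `ℋom^•(F, I)_p` with `Hom^•(F_{p ∪ q}, I_{p ∪ q})`
(`quasiIso_evalStalk_of_isFree`). The injective resolution `I` of `ω` is acyclic at all points
except the open point `𝟏`, where it is a bounded below complex `J` of injective modules which
resolves `k`. So the dual of `F` vanishes at `p`, up to quasi-isomorphism, unless `p ∪ q = 𝟏`,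
that is `qᶜ ⊆ p`, and is `Hom^•(F_𝟏, J)` there: it is again free, on `U_{qᶜ}`, up to
quasi-isomorphism (`IsDualizing.quasiIso_freeCounit`). Dualizing twice, the biduality morphism of
`F` is a quasi-isomorphism as soon as that of the complex of modules `F_𝟏` with respect to `J` is
(`IsDualizing.isReflexive_of_isFree`).

*Dévissage.* Let `F` be acyclic outside of an upper set `S`, and let `p` be minimal in `S`. The
morphism to `F` from the free sheaf on `U_p` with stalk `F_p` is an isomorphism at `p`, so its
cone is acyclic outside of `S \ {p}`. As duality is exact, an induction on `S` shows that `F` is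
reflexive if its stalks belong to a class of complexes of modules that is stable under
quasi-isomorphisms and extensions, and all of whose members are reflexive with respect to `J`
(`isReflexive_of_acyclic_off`).

*Modules.* For perfect complexes, reflexivity with respect to `J` is the reflexivity of finitely
generated projective modules (`isPerfect_dual`). In the Gorenstein case, the injective dimension
of a local ring, if finite, is at most its Krull dimension
(`hasInjectiveDimensionLE_self_of_isLocalRing`): the residue field embeds into a module of finite
projective dimension obtained by dividing by a regular sequence, so that the top `Ext` into the
ring vanishes on it, hence on all finitely generated modules. So a Gorenstein ring of finite Krull
dimension has finite injective dimension over itself (`exists_hasInjectiveDimensionLE`), and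
`Hom^•(-, J)` has finite cohomological amplitude. The parts of a complex in high or low degrees
then do not matter in a given degree, and a complex with finitely generated cohomology that is
bounded above is approximated by perfect complexes, by killing its top cohomology with finitely
generated free modules (`hasFGHomology_homCx`, `quasiIso_ev_of_hasFGHomology`).
-/

noncomputable section

namespace F1

/-! ### Homology of complexes of modules by elements -/

section Elements

variable {k : Type u} [CommRing k]

lemma exactAt_iff_forall_exists (A : CochainComplex (ModuleCat.{u} k) ℤ) (i j l : ℤ)
    (hi : i + 1 = j) (hl : j + 1 = l) :
    A.ExactAt j ↔ ∀ x : A.X j, (A.d j l).hom x = 0 → ∃ y : A.X i, (A.d i j).hom y = x := by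
  rw [A.exactAt_iff' i j l (by simp [← hi]) (by simp [← hl]), ShortComplex.moduleCat_exact_iff]
  rfl

lemma homologyπ_eq_zero_iff (A : CochainComplex (ModuleCat.{u} k) ℤ) (i j : ℤ) (hi : i + 1 = j)
    (z : A.cycles j) :
    (A.homologyπ j).hom z = 0 ↔ ∃ y : A.X i, (A.toCycles i j).hom y = z := by
  have h := ShortComplex.exact_of_g_is_cokernel
    (ShortComplex.mk (A.toCycles i j) (A.homologyπ j) (A.toCycles_comp_homologyπ i j))
    (A.homologyIsCokernel i j (by simp [← hi]))
  rw [ShortComplex.moduleCat_exact_iff] at h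
  refine ⟨h z, ?_⟩
  rintro ⟨y, rfl⟩
  exact congrArg (fun f => f.hom y) (A.toCycles_comp_homologyπ i j)

lemma exists_cycles (A : CochainComplex (ModuleCat.{u} k) ℤ) (j l : ℤ) (hl : j + 1 = l)
    (x : A.X j) (hx : (A.d j l).hom x = 0) : ∃ z : A.cycles j, (A.iCycles j).hom z = x := by
  have h := ShortComplex.exact_of_f_is_kernel
    (ShortComplex.mk (A.iCycles j) (A.d j l) (A.iCycles_d j l))
    (A.cyclesIsKernel j l (by simp [← hl]))
  rw [ShortComplex.moduleCat_exact_iff] at h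
  exact h x hx

lemma iCycles_injective (A : CochainComplex (ModuleCat.{u} k) ℤ) (j : ℤ) :
    Function.Injective (A.iCycles j).hom :=
  (ModuleCat.mono_iff_injective _).1 inferInstance

lemma homologyπ_surjective (A : CochainComplex (ModuleCat.{u} k) ℤ) (j : ℤ) :
    Function.Surjective (A.homologyπ j).hom :=
  (ModuleCat.epi_iff_surjective _).1 inferInstance

lemma d_iCycles (A : CochainComplex (ModuleCat.{u} k) ℤ) (j l : ℤ) (z : A.cycles j) :
    (A.d j l).hom ((A.iCycles j).hom z) = 0 :=
  congrArg (fun f => f.hom z) (A.iCycles_d j l)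

lemma iCycles_toCycles (A : CochainComplex (ModuleCat.{u} k) ℤ) (i j : ℤ) (y : A.X i) :
    (A.iCycles j).hom ((A.toCycles i j).hom y) = (A.d i j).hom y :=
  congrArg (fun f => f.hom y) (A.toCycles_i i j)

/-- A morphism of complexes of modules is a quasi-isomorphism if a cycle of the source is a boundary
as soon as its image is, and every cycle of the target is the image of a cycle up to a boundary. -/
lemma quasiIso_of_elements {A B : CochainComplex (ModuleCat.{u} k) ℤ} (f : A ⟶ B)
    (h₁ : ∀ (i j l : ℤ), i + 1 = j → j + 1 = l → ∀ (x : A.X j) (y : B.X i),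
      (A.d j l).hom x = 0 → (f.f j).hom x = (B.d i j).hom y → ∃ w : A.X i, (A.d i j).hom w = x)
    (h₂ : ∀ (i j l : ℤ), i + 1 = j → j + 1 = l → ∀ (y : B.X j), (B.d j l).hom y = 0 →
      ∃ (x : A.X j) (w : B.X i), (A.d j l).hom x = 0 ∧ (f.f j).hom x = y + (B.d i j).hom w) :
    QuasiIso f := by
  rw [quasiIso_iff]
  intro j
  rw [quasiIsoAt_iff_isIso_homologyMap]
  have hi : (j - 1) + 1 = j := by lia
  have hπ (z : A.cycles j) : (HomologicalComplex.homologyMap f j).hom ((A.homologyπ j).hom z) =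
      (B.homologyπ j).hom ((HomologicalComplex.cyclesMap f j).hom z) :=
    congrArg (fun g => g.hom z) (HomologicalComplex.homologyπ_naturality f j)
  have hc (z : A.cycles j) : (B.iCycles j).hom ((HomologicalComplex.cyclesMap f j).hom z) =
      (f.f j).hom ((A.iCycles j).hom z) :=
    congrArg (fun g => g.hom z) (HomologicalComplex.cyclesMap_i f j)
  have : Mono (HomologicalComplex.homologyMap f j) := by
    rw [ModuleCat.mono_iff_injective, ← LinearMap.ker_eq_bot, LinearMap.ker_eq_bot']
    intro x hx
    obtain ⟨z, rfl⟩ := homologyπ_surjective A j x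
    rw [hπ, homologyπ_eq_zero_iff B (j - 1) j hi] at hx
    obtain ⟨y, hy⟩ := hx
    obtain ⟨t, ht⟩ := h₁ (j - 1) j (j + 1) hi rfl ((A.iCycles j).hom z) y (d_iCycles _ _ _ _)
      (by rw [← hc, ← hy, iCycles_toCycles])
    exact (homologyπ_eq_zero_iff A (j - 1) j hi z).2
      ⟨t, iCycles_injective A j (by rw [iCycles_toCycles, ht])⟩
  have : Epi (HomologicalComplex.homologyMap f j) := by
    rw [ModuleCat.epi_iff_surjective]
    intro y
    obtain ⟨z, rfl⟩ := homologyπ_surjective B j y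
    obtain ⟨x, t, hx, ht⟩ := h₂ (j - 1) j (j + 1) hi rfl _ (d_iCycles _ _ _ z)
    obtain ⟨z', rfl⟩ := exists_cycles A j (j + 1) rfl x hx
    refine ⟨(A.homologyπ j).hom z', ?_⟩
    rw [← sub_eq_zero]
    change (HomologicalComplex.homologyMap f j).hom ((A.homologyπ j).hom z') - _ = 0
    rw [hπ, ← map_sub, homologyπ_eq_zero_iff B (j - 1) j hi]
    exact ⟨t, iCycles_injective B j (by rw [iCycles_toCycles, map_sub, hc, ht]; abel)⟩
  exact isIso_of_mono_of_epi _

/-- A morphism of complexes of modules which is bijective in each degree is a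
quasi-isomorphism. -/
lemma quasiIso_of_bijective {A B : CochainComplex (ModuleCat.{u} k) ℤ} (f : A ⟶ B)
    (h : ∀ i, Function.Bijective (f.f i).hom) : QuasiIso f := by
  have (i : ℤ) : IsIso (f.f i) := (ConcreteCategory.isIso_iff_bijective _).2 (h i)
  have : IsIso f := HomologicalComplex.Hom.isIso_of_components f
  infer_instance

end Elements

/-! ### The five lemma for short exact sequences of complexes -/

section FiveLemma

open HomologicalComplex HomologicalComplex.HomologySequence ComposableArrows Abelian

variable {C : Type*} [Category* C] [Abelian C]
  {S₁ S₂ : ShortComplex (CochainComplex C ℤ)} (φ : S₁ ⟶ S₂) (hS₁ : S₁.ShortExact)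
  (hS₂ : S₂.ShortExact)

include hS₁ hS₂

lemma mono_homologyMap_τ₁ (i j : ℤ) (hij : i + 1 = j) (h₁ : Epi (homologyMap φ.τ₂ i))
    (h₂ : Mono (homologyMap φ.τ₃ i)) (h₃ : Mono (homologyMap φ.τ₂ j)) :
    Mono (homologyMap φ.τ₁ j) :=
  mono_of_epi_of_mono_of_mono
    ((δ₀Functor ⋙ δlastFunctor).map (mapComposableArrows₅ φ hS₁ hS₂ i j hij))
    (composableArrows₅_exact hS₁ i j hij).δ₀.δlast
    (composableArrows₅_exact hS₂ i j hij).δ₀.δlast h₁ h₂ h₃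

lemma epi_homologyMap_τ₁ (i j : ℤ) (hij : i + 1 = j) (h₁ : Epi (homologyMap φ.τ₃ i))
    (h₂ : Epi (homologyMap φ.τ₂ j)) (h₃ : Mono (homologyMap φ.τ₃ j)) :
    Epi (homologyMap φ.τ₁ j) :=
  epi_of_epi_of_epi_of_mono
    ((δ₀Functor ⋙ δ₀Functor).map (mapComposableArrows₅ φ hS₁ hS₂ i j hij))
    (composableArrows₅_exact hS₁ i j hij).δ₀.δ₀
    (composableArrows₅_exact hS₂ i j hij).δ₀.δ₀ h₁ h₂ h₃

lemma mono_homologyMap_τ₂ (i j : ℤ) (hij : i + 1 = j) (h₁ : Epi (homologyMap φ.τ₃ i))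
    (h₂ : Mono (homologyMap φ.τ₁ j)) (h₃ : Mono (homologyMap φ.τ₃ j)) :
    Mono (homologyMap φ.τ₂ j) :=
  mono_of_epi_of_mono_of_mono
    ((δ₀Functor ⋙ δ₀Functor).map (mapComposableArrows₅ φ hS₁ hS₂ i j hij))
    (composableArrows₅_exact hS₁ i j hij).δ₀.δ₀
    (composableArrows₅_exact hS₂ i j hij).δ₀.δ₀ h₁ h₂ h₃

lemma epi_homologyMap_τ₂ (i j : ℤ) (hij : i + 1 = j) (h₁ : Epi (homologyMap φ.τ₁ i))
    (h₂ : Epi (homologyMap φ.τ₃ i)) (h₃ : Mono (homologyMap φ.τ₁ j)) :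
    Epi (homologyMap φ.τ₂ i) :=
  epi_of_epi_of_epi_of_mono
    ((δlastFunctor ⋙ δlastFunctor).map (mapComposableArrows₅ φ hS₁ hS₂ i j hij))
    (composableArrows₅_exact hS₁ i j hij).δlast.δlast
    (composableArrows₅_exact hS₂ i j hij).δlast.δlast h₁ h₂ h₃

lemma quasiIso_τ₁ (h₂ : QuasiIso φ.τ₂) (h₃ : QuasiIso φ.τ₃) : QuasiIso φ.τ₁ := by
  rw [quasiIso_iff]
  intro i
  rw [quasiIsoAt_iff_isIso_homologyMap]
  have := mono_homologyMap_τ₁ φ hS₁ hS₂ (i - 1) i (by lia) inferInstance inferInstance inferInstance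
  have := epi_homologyMap_τ₁ φ hS₁ hS₂ (i - 1) i (by lia) inferInstance inferInstance inferInstance
  exact isIso_of_mono_of_epi _

end FiveLemma

/-! ### Mapping cones -/

section MappingCone

variable {C : Type*} [Category* C] [Abelian C]

lemma mappingCone_acyclic {K L : CochainComplex C ℤ} (f : K ⟶ L) [QuasiIso f] :
    (CochainComplex.mappingCone f).Acyclic := by
  rw [← HomotopyCategory.quotient_obj_mem_subcategoryAcyclic_iff_acyclic]
  have h : HomotopyCategory.quasiIso C (ComplexShape.up ℤ)
      ((HomotopyCategory.quotient _ _).map f) := by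
    rw [HomotopyCategory.quotient_map_mem_quasiIso_iff]
    exact (inferInstance : QuasiIso f)
  rw [HomotopyCategory.quasiIso_eq_trW_subcategoryAcyclic] at h
  exact (ObjectProperty.trW_iff_of_distinguished _ _
    (HomotopyCategory.mappingCone_triangleh_distinguished f)).1 h

/-- The short exact sequence `0 ⟶ L ⟶ Cone(f) ⟶ K⟦1⟧ ⟶ 0` of a morphism `f : K ⟶ L`. -/
lemma mappingCone_shortExact {K L : CochainComplex C ℤ} (f : K ⟶ L) :
    (CochainComplex.mappingCone.triangleRotateShortComplex f).ShortExact :=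
  HomologicalComplex.shortExact_of_degreewise_shortExact _ fun n =>
    (CochainComplex.mappingCone.triangleRotateShortComplexSplitting f n).shortExact

end MappingCone

/-! ### Complexes of homomorphisms -/

section HomCx

variable (k : Type u) [CommRing k] {C : Type*} [Category.{u} C]

section Preadditive

variable [Preadditive C] [Linear k C]

/-- The complex `Hom^•(K, L)` of `k`-modules, for complexes `K` and `L` in a `k`-linear category:
in degree `m` it consists of the families of morphisms `K^a ⟶ L^(a + m)`. -/
def homCx (K L : CochainComplex C ℤ) : CochainComplex (ModuleCat.{u} k) ℤ where
  X m := ModuleCat.of k (Cochain K L m)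
  d m m' := ModuleCat.ofHom (δ_hom k K L m m')
  shape m m' h := by
    ext φ : 2
    exact δ_shape m m' h φ
  d_comp_d' m m' m'' _ _ := by
    ext φ : 2
    exact δ_δ m m' m'' φ

/-- The morphism `Hom^•(K', L) ⟶ Hom^•(K, L)` given by a morphism `K ⟶ K'`. -/
def homCxPre {K K' : CochainComplex C ℤ} (f : K ⟶ K') (L : CochainComplex C ℤ) :
    homCx k K' L ⟶ homCx k K L where
  f m := ModuleCat.ofHom
    { toFun := fun φ : Cochain K' L m => (Cochain.ofHom f).comp φ (zero_add m)
      map_add' := fun φ ψ => Cochain.comp_add _ _ _ _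
      map_smul' := fun c φ => Cochain.comp_smul _ _ _ _ }
  comm' m m' _ := by
    ext φ : 2
    exact δ_ofHom_comp f φ m'

/-- The morphism `Hom^•(K, L) ⟶ Hom^•(K, L')` given by a morphism `L ⟶ L'`. -/
def homCxPost (K : CochainComplex C ℤ) {L L' : CochainComplex C ℤ} (g : L ⟶ L') :
    homCx k K L ⟶ homCx k K L' where
  f m := ModuleCat.ofHom
    { toFun := fun φ : Cochain K L m => φ.comp (Cochain.ofHom g) (add_zero m)
      map_add' := fun φ ψ => Cochain.add_comp _ _ _ _
      map_smul' := fun c φ => Cochain.smul_comp _ _ _ _ }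
  comm' m m' _ := by
    ext φ : 2
    exact δ_comp_ofHom φ g m'

variable {k}

lemma homCxPre_comp {K K' K'' : CochainComplex C ℤ} (f : K ⟶ K') (g : K' ⟶ K'')
    (L : CochainComplex C ℤ) : homCxPre k (f ≫ g) L = homCxPre k g L ≫ homCxPre k f L := by
  refine HomologicalComplex.hom_ext _ _ fun m =>
    ModuleCat.hom_ext (LinearMap.ext fun (φ : Cochain K'' L m) => ?_)
  change (Cochain.ofHom (f ≫ g)).comp φ (zero_add m) =
    (Cochain.ofHom f).comp ((Cochain.ofHom g).comp φ (zero_add m)) (zero_add m)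
  rw [Cochain.ofHom_comp, Cochain.comp_assoc_of_first_is_zero_cochain]

lemma homCxPre_zero {K K' : CochainComplex C ℤ} (L : CochainComplex C ℤ) :
    homCxPre k (0 : K ⟶ K') L = 0 := by
  refine HomologicalComplex.hom_ext _ _ fun m =>
    ModuleCat.hom_ext (LinearMap.ext fun (φ : Cochain K' L m) => ?_)
  change (Cochain.ofHom 0).comp φ (zero_add m) = 0
  rw [Cochain.ofHom_zero, Cochain.zero_comp]

/-- A short exact sequence of complexes `K` gives a short exact sequence of the `Hom^•(K, L)`,
if all terms of `L` are injective. -/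
lemma homCx_shortExact {C : Type*} [Category.{u} C] [Abelian C] [Linear k C]
    {S : ShortComplex (CochainComplex C ℤ)} (hS : S.ShortExact)
    (L : CochainComplex C ℤ) (hL : ∀ i, Injective (L.X i)) :
    (ShortComplex.mk (homCxPre k S.g L) (homCxPre k S.f L)
      (by rw [← homCxPre_comp, S.zero, homCxPre_zero])).ShortExact := by
  have hS' (n : ℤ) : (S.map (HomologicalComplex.eval C _ n)).ShortExact :=
    hS.map_of_exact _
  refine HomologicalComplex.shortExact_of_degreewise_shortExact _ fun m => ?_
  refine ModuleCat.shortComplex_shortExact _ ?_ ?_ ?_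
  · rw [← ShortComplex.ShortExact.moduleCat_exact_iff_function_exact,
      ShortComplex.moduleCat_exact_iff]
    intro (φ : Cochain S.X₂ L m) (hφ : (Cochain.ofHom S.f).comp φ (zero_add m) = 0)
    have h (a b : ℤ) (hab : a + m = b) : S.f.f a ≫ φ.v a b hab = 0 := by
      have := Cochain.congr_v hφ a b hab
      rwa [Cochain.zero_cochain_comp_v, Cochain.ofHom_v] at this
    have e (a : ℤ) : Epi (S.map (HomologicalComplex.eval C _ a)).g := (hS' a).epi_g
    let ψ : Cochain S.X₃ L m :=
      Cochain.mk fun a b hab => (hS' a).exact.desc (φ.v a b hab) (h a b hab)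
    refine ⟨ψ, ?_⟩
    change (Cochain.ofHom S.g).comp ψ (zero_add m) = φ
    ext a b hab
    rw [Cochain.zero_cochain_comp_v, Cochain.ofHom_v]
    exact (hS' a).exact.g_desc (φ.v a b hab) (h a b hab)
  · rw [injective_iff_map_eq_zero]
    intro (φ : Cochain S.X₃ L m) (hφ : (Cochain.ofHom S.g).comp φ (zero_add m) = 0)
    change φ = 0
    ext a b hab
    have := Cochain.congr_v hφ a b hab
    rw [Cochain.zero_cochain_comp_v, Cochain.ofHom_v] at this
    have : Epi (S.g.f a) := (hS' a).epi_g
    rw [← cancel_epi (S.g.f a)]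
    simpa using ‹S.g.f a ≫ φ.v a b hab = _›
  · intro (φ : Cochain S.X₁ L m)
    have e (a : ℤ) : Mono (S.f.f a) := (hS' a).mono_f
    let ψ : Cochain S.X₂ L m :=
      Cochain.mk fun a b hab => Injective.factorThru (φ.v a b hab) (S.f.f a)
    refine ⟨ψ, ?_⟩
    change (Cochain.ofHom S.f).comp ψ (zero_add m) = φ
    ext a b hab
    rw [Cochain.zero_cochain_comp_v, Cochain.ofHom_v]
    exact Injective.comp_factorThru _ _

end Preadditive

variable [Abelian C] [Linear k C] {k}

/-- Precomposition with `f` is a quasi-isomorphism on `Hom^•(-, L)` if `Hom^•(Cone(f), L)` is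
acyclic. -/
lemma quasiIso_homCxPre_of_mappingCone {K K' : CochainComplex C ℤ} (f : K ⟶ K')
    (L : CochainComplex C ℤ)
    (h : ∀ (m n : ℤ), m + 1 = n → ∀ z : Cocycle (CochainComplex.mappingCone f) L n,
      ∃ α : Cochain (CochainComplex.mappingCone f) L m, δ m n α = z.1) :
    QuasiIso (homCxPre k f L) := by
  refine quasiIso_of_elements _ ?_ ?_
  · intro i j l hi hl (x : Cochain K' L j) (y : Cochain K L i) (hx : δ j l x = 0)
      (hy : (Cochain.ofHom f).comp x (zero_add j) = δ i j y)
    obtain ⟨α, hα⟩ := h i j hi (CochainComplex.mappingCone.descCocycle f (j.negOnePow • y)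
      (Cocycle.mk x l hl hx) hi (by rw [δ_units_smul, ← hy, Cocycle.mk_coe]))
    refine ⟨(Cochain.ofHom (CochainComplex.mappingCone.inr f)).comp α (zero_add i), ?_⟩
    change δ i j _ = x
    rw [δ_ofHom_comp, hα]
    simp
  · intro i j l hi hl (y : Cochain K L j) (hy : δ j l y = 0)
    obtain ⟨α, hα⟩ := h j l hl (Cocycle.mk
      ((CochainComplex.mappingCone.fst f).1.comp y (show 1 + j = l by lia)) (l + 1) rfl (by
        rw [δ_comp (CochainComplex.mappingCone.fst f).1 y _ 2 l _ rfl rfl hl, hy]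
        simp))
    rw [Cocycle.mk_coe] at hα
    have e₁ : δ j l
        ((Cochain.ofHom (CochainComplex.mappingCone.inr f)).comp α (zero_add j)) = 0 := by
      rw [δ_ofHom_comp, hα]
      simp
    have e₂ := δ_comp (CochainComplex.mappingCone.inl f) α (show -1 + j = i by lia) 0 l j hi
      (by lia) hl
    rw [hα, CochainComplex.mappingCone.δ_inl] at e₂
    simp only [Int.reduceNeg, CochainComplex.mappingCone.inl_fst_assoc, Cochain.ofHom_comp] at e₂
    refine ⟨-(j.negOnePow • (Cochain.ofHom (CochainComplex.mappingCone.inr f)).comp α (zero_add j)),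
      -(CochainComplex.mappingCone.inl f).comp α (show -1 + j = i by lia), ?_, ?_⟩
    · change δ j l (-_) = 0
      rw [δ_neg, δ_units_smul, e₁, smul_zero, neg_zero]
    · change (Cochain.ofHom f).comp (-(j.negOnePow • _)) (zero_add j) = y + δ i j (-_)
      rw [δ_neg, e₂, Cochain.comp_neg, Cochain.comp_units_smul,
        Cochain.comp_assoc_of_first_is_zero_cochain]
      abel

/-- Composition with `g` is a quasi-isomorphism on `Hom^•(K, -)` if `Hom^•(K, Cone(g))` is
acyclic. -/
lemma quasiIso_homCxPost_of_mappingCone (K : CochainComplex C ℤ) {L L' : CochainComplex C ℤ}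
    (g : L ⟶ L')
    (h : ∀ (m n : ℤ), m + 1 = n → ∀ z : Cocycle K (CochainComplex.mappingCone g) n,
      ∃ α : Cochain K (CochainComplex.mappingCone g) m, δ m n α = z.1) :
    QuasiIso (homCxPost k K g) := by
  refine quasiIso_of_elements _ ?_ ?_
  · intro i j l hi hl (x : Cochain K L j) (y : Cochain K L' i) (hx : δ j l x = 0)
      (hy : x.comp (Cochain.ofHom g) (add_zero j) = δ i j y)
    obtain ⟨α, hα⟩ := h (i - 1) i (by lia) (CochainComplex.mappingCone.liftCocycle g
      (Cocycle.mk x l hl hx) (-y) hi (by rw [δ_neg, ← hy, Cocycle.mk_coe]; abel))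
    refine ⟨-α.comp (CochainComplex.mappingCone.fst g).1 (show i - 1 + 1 = i by lia), ?_⟩
    change δ i j (-_) = x
    rw [δ_neg, δ_comp α (CochainComplex.mappingCone.fst g).1 _ i 2 j hi (by lia) rfl, hα]
    simp
  · intro i j l hi hl (y : Cochain K L' j) (hy : δ j l y = 0)
    obtain ⟨α, hα⟩ := h i j hi (Cocycle.mk
      (y.comp (Cochain.ofHom (CochainComplex.mappingCone.inr g)) (add_zero j)) l hl (by
        rw [δ_comp_ofHom, hy, Cochain.zero_comp]))
    rw [Cocycle.mk_coe] at hα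
    refine ⟨α.comp (CochainComplex.mappingCone.fst g).1 hi,
      -α.comp (CochainComplex.mappingCone.snd g) (add_zero i), ?_, ?_⟩
    · change δ j l _ = 0
      rw [δ_comp α (CochainComplex.mappingCone.fst g).1 hi j 2 l hl hi rfl, hα]
      simp
    · change (α.comp _ hi).comp _ (add_zero j) = y + δ i j (-_)
      rw [δ_neg, δ_comp_zero_cochain _ _ _ hi, hα, CochainComplex.mappingCone.δ_snd]
      simp only [Cochain.comp_assoc_of_second_is_zero_cochain, Cochain.comp_neg,
        CochainComplex.mappingCone.inr_snd, Cochain.comp_id,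
        Cochain.comp_assoc_of_third_is_zero_cochain]
      abel

instance quasiIso_homCxPre {K K' : CochainComplex C ℤ} (f : K ⟶ K') [QuasiIso f]
    (L : CochainComplex C ℤ) [L.IsKInjective] : QuasiIso (homCxPre k f L) :=
  quasiIso_homCxPre_of_mappingCone f L fun m _ h z =>
    CochainComplex.IsKInjective.eq_δ_of_cocycle z (mappingCone_acyclic f) m h

lemma homCx_acyclic_of_left {K : CochainComplex C ℤ} (hK : K.Acyclic) (L : CochainComplex C ℤ)
    [L.IsKInjective] : (homCx k K L).Acyclic := fun n => by
  rw [exactAt_iff_forall_exists _ (n - 1) n (n + 1) (by lia) rfl]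
  intro (z : Cochain K L n) (hz : δ n (n + 1) z = 0)
  exact CochainComplex.IsKInjective.eq_δ_of_cocycle (Cocycle.mk z (n + 1) rfl hz) hK _ (by lia)

lemma homCx_acyclic_of_right (K : CochainComplex C ℤ) {L : CochainComplex C ℤ} (hL : L.Acyclic)
    [L.IsKInjective] : (homCx k K L).Acyclic := fun n => by
  rw [exactAt_iff_forall_exists _ (n - 1) n (n + 1) (by lia) rfl]
  intro (z : Cochain K L n) (hz : δ n (n + 1) z = 0)
  exact CochainComplex.IsKInjective.eq_δ_of_cocycle' (Cocycle.mk z (n + 1) rfl hz) hL _ (by lia)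

/-- Cocycles of homomorphisms from a K-projective complex to an acyclic complex are boundaries. -/
lemma eq_δ_of_cocycle_of_isKProjective {K L : CochainComplex C ℤ} {n : ℤ}
    (z : Cocycle K L n) [K.IsKProjective] (hL : L.Acyclic) (m : ℤ) (hm : m + 1 = n) :
    ∃ (α : Cochain K L m), δ m n α = z.1 := by
  let φ : K ⟶ L⟦n⟧ := Cocycle.homOf (z.rightShift n 0 (zero_add n))
  have hφ : Cochain.ofHom φ = z.1.rightShift n 0 (zero_add n) :=
    Cocycle.cochain_ofHom_homOf_eq_coe _
  have hL' : (L⟦n⟧).Acyclic := by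
    rw [← HomotopyCategory.quotient_obj_mem_subcategoryAcyclic_iff_acyclic] at hL ⊢
    exact ObjectProperty.prop_of_iso _ (((HomotopyCategory.quotient C _).commShiftIso n).symm.app L)
      ((HomotopyCategory.subcategoryAcyclic C).le_shift n _ hL)
  obtain ⟨h⟩ := CochainComplex.IsKProjective.nonempty_homotopy_zero φ hL'
  obtain ⟨f, hf⟩ := Cochain.equivHomotopy _ _ h
  rw [Cochain.ofHom_zero, add_zero] at hf
  refine ⟨n.negOnePow • Cochain.rightUnshift f m (by lia), ?_⟩
  rw [δ_units_smul, Cochain.δ_rightUnshift f m (by lia) n 0 (by lia), smul_smul,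
    Int.units_mul_self, one_smul, ← hf, hφ, Cochain.rightUnshift_rightShift]

lemma quasiIso_homCxPost_of_isKProjective (K : CochainComplex C ℤ) [K.IsKProjective]
    {L L' : CochainComplex C ℤ} (g : L ⟶ L') [QuasiIso g] : QuasiIso (homCxPost k K g) :=
  quasiIso_homCxPost_of_mappingCone K g fun m _ h z =>
    eq_δ_of_cocycle_of_isKProjective z (mappingCone_acyclic g) m h

/-- For bounded below complexes of injectives, the mapping cone of a quasi-isomorphism is
K-injective and acyclic, so that `Hom^•(K, -)` preserves the quasi-isomorphism for all `K`. -/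
lemma quasiIso_homCxPost_of_injective (K : CochainComplex C ℤ) {L L' : CochainComplex C ℤ}
    (g : L ⟶ L') [QuasiIso g] (d : ℤ) [L.IsStrictlyGE d] [L'.IsStrictlyGE d]
    (hL : ∀ i, Injective (L.X i)) (hL' : ∀ i, Injective (L'.X i)) :
    QuasiIso (homCxPost k K g) := by
  have h (i : ℤ) : ((CochainComplex.mappingCone.triangleRotateShortComplex g).map
      (HomologicalComplex.eval C _ i)).Splitting :=
    CochainComplex.mappingCone.triangleRotateShortComplexSplitting g i
  have (i : ℤ) : Injective ((CochainComplex.mappingCone g).X i) := by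
    have : Injective (L'.X i ⊞ L.X (i + 1)) := inferInstance
    exact Injective.of_iso (HomologicalComplex.homotopyCofiber.XIsoBiprod g i (i + 1) rfl ≪≫
      biprod.braiding _ _).symm this
  have : (CochainComplex.mappingCone g).IsStrictlyGE (d - 1) := by
    rw [CochainComplex.isStrictlyGE_iff]
    intro i hi
    rw [CochainComplex.mappingCone.isZero_X_iff]
    exact ⟨L.isZero_of_isStrictlyGE d _ (by lia), L'.isZero_of_isStrictlyGE d _ (by lia)⟩
  have := CochainComplex.isKInjective_of_injective (CochainComplex.mappingCone g) (d - 1)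
  exact quasiIso_homCxPost_of_mappingCone K g fun m _ h z =>
    CochainComplex.IsKInjective.eq_δ_of_cocycle' z (mappingCone_acyclic g) m h

end HomCx

/-! ### Biduality for complexes of modules -/

section Biduality

variable {k : Type u} [CommRing k]

/-- Cochains with source `Hom^•(E, J)` are equal if they take the same values. -/
lemma cochain_homCx_ext {C : Type*} [Category.{u} C] [Preadditive C] [Linear k C]
    {E J : CochainComplex C ℤ} {L : CochainComplex (ModuleCat.{u} k) ℤ} {m : ℤ}
    {Φ Ψ : Cochain (homCx k E J) L m} (h : ∀ (a b : ℤ) (hab : a + m = b) (φ : Cochain E J a),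
      (Φ.v a b hab).hom φ = (Ψ.v a b hab).hom φ) : Φ = Ψ := by
  ext a b hab : 1
  exact ModuleCat.hom_ext (LinearMap.ext fun φ => h a b hab φ)

/-- The evaluation at `x ∈ E^m` of homomorphisms `E ⟶ J`, as a cochain of degree `m` of
homomorphisms `Hom^•(E, J) ⟶ J`. -/
def evCochain (E J : CochainComplex (ModuleCat.{u} k) ℤ) (m : ℤ) :
    E.X m →ₗ[k] Cochain (homCx k E J) J m where
  toFun x := Cochain.mk fun a b hab => ModuleCat.ofHom
    { toFun := fun φ : Cochain E J a => (m * a).negOnePow • (φ.v m b (by lia)).hom x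
      map_add' := fun φ ψ => by rw [← smul_add]; rfl
      map_smul' := fun c φ => by rw [RingHom.id_apply, smul_comm c]; rfl }
  map_add' x y := by
    refine cochain_homCx_ext fun a b hab φ => ?_
    change (m * a).negOnePow • (φ.v m b (by lia)).hom (x + y) =
      (m * a).negOnePow • (φ.v m b (by lia)).hom x + (m * a).negOnePow • (φ.v m b (by lia)).hom y
    rw [map_add, smul_add]
  map_smul' c x := by
    refine cochain_homCx_ext fun a b hab φ => ?_
    change (m * a).negOnePow • (φ.v m b (by lia)).hom (c • x) =
      c • (m * a).negOnePow • (φ.v m b (by lia)).hom x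
    rw [map_smul, smul_comm]

lemma evCochain_v_apply (E J : CochainComplex (ModuleCat.{u} k) ℤ) (m : ℤ) (x : E.X m) (a b : ℤ)
    (hab : a + m = b) (φ : Cochain E J a) :
    ((evCochain E J m x).v a b hab).hom φ =
      (m * a).negOnePow • (φ.v m b (by lia)).hom x := rfl

/-- The biduality morphism `E ⟶ Hom^•(Hom^•(E, J), J)` for complexes of modules. -/
def ev (E J : CochainComplex (ModuleCat.{u} k) ℤ) : E ⟶ homCx k (homCx k E J) J where
  f m := ModuleCat.ofHom (evCochain E J m)
  comm' m m' h := by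
    obtain rfl : m + 1 = m' := h
    ext x : 2
    change δ m (m + 1) (evCochain E J m x) = evCochain E J (m + 1) ((E.d m (m + 1)).hom x)
    refine cochain_homCx_ext fun a b hab φ => ?_
    rw [δ_v m (m + 1) rfl _ a b hab (b - 1) (a + 1) rfl rfl]
    change (J.d (b - 1) b).hom ((m * a).negOnePow • (φ.v m (b - 1) (by lia)).hom x) +
      (m + 1).negOnePow • (m * (a + 1)).negOnePow • ((δ a (a + 1) φ).v m b (by lia)).hom x =
      ((m + 1) * a).negOnePow • (φ.v (m + 1) b (by lia)).hom ((E.d m (m + 1)).hom x)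
    rw [δ_v a (a + 1) rfl _ m b (by lia) (b - 1) (m + 1) rfl rfl]
    change _ + (m + 1).negOnePow • (m * (a + 1)).negOnePow •
      ((J.d (b - 1) b).hom ((φ.v m (b - 1) (by lia)).hom x) +
        (a + 1).negOnePow • (φ.v (m + 1) b (by lia)).hom ((E.d m (m + 1)).hom x)) = _
    have h₁ : (m + 1).negOnePow * (m * (a + 1)).negOnePow = -(m * a).negOnePow := by
      rw [← Int.negOnePow_add, ← Int.negOnePow_succ, Int.negOnePow_eq_iff]
      exact ⟨m, by ring⟩
    have h₂ : (m + 1).negOnePow * (m * (a + 1)).negOnePow * (a + 1).negOnePow =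
        ((m + 1) * a).negOnePow := by
      rw [← Int.negOnePow_add, ← Int.negOnePow_add, Int.negOnePow_eq_iff]
      exact ⟨m + 1, by ring⟩
    rw [smul_add, smul_add, smul_smul, smul_smul, smul_smul, h₂, h₁]
    simp only [Units.smul_def, map_zsmul, Units.val_neg, neg_smul]
    abel

lemma ev_naturality {E E' : CochainComplex (ModuleCat.{u} k) ℤ} (f : E ⟶ E')
    (J : CochainComplex (ModuleCat.{u} k) ℤ) :
    ev E J ≫ homCxPre k (homCxPre k f J) J = f ≫ ev E' J := by
  refine HomologicalComplex.hom_ext _ _ fun m => ModuleCat.hom_ext (LinearMap.ext fun x => ?_)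
  refine cochain_homCx_ext fun a b hab φ => ?_
  change (((Cochain.ofHom (homCxPre k f J)).comp (evCochain E J m x)
      (zero_add m)).v a b hab).hom φ =
    ((evCochain E' J m ((f.f m).hom x)).v a b hab).hom φ
  rw [Cochain.zero_cochain_comp_v, Cochain.ofHom_v]
  change (m * a).negOnePow • (((Cochain.ofHom f).comp φ (zero_add a)).v m b (by lia)).hom x =
    (m * a).negOnePow • (φ.v m b (by lia)).hom ((f.f m).hom x)
  rw [Cochain.zero_cochain_comp_v, Cochain.ofHom_v]
  rfl

lemma ev_comp_homCxPre_homCxPost (E : CochainComplex (ModuleCat.{u} k) ℤ)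
    {J J' : CochainComplex (ModuleCat.{u} k) ℤ} (g : J' ⟶ J) :
    ev E J ≫ homCxPre k (homCxPost k E g) J = ev E J' ≫ homCxPost k (homCx k E J') g := by
  refine HomologicalComplex.hom_ext _ _ fun m => ModuleCat.hom_ext (LinearMap.ext fun x => ?_)
  refine cochain_homCx_ext fun a b hab φ => ?_
  change (((Cochain.ofHom (homCxPost k E g)).comp (evCochain E J m x) (zero_add m)).v a b hab).hom φ
    = (((evCochain E J' m x).comp (Cochain.ofHom g) (add_zero m)).v a b hab).hom φ
  rw [Cochain.zero_cochain_comp_v, Cochain.ofHom_v, Cochain.comp_zero_cochain_v, Cochain.ofHom_v]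
  change (m * a).negOnePow • ((φ.comp (Cochain.ofHom g) (add_zero a)).v m b (by lia)).hom x =
    (g.f b).hom ((m * a).negOnePow • (φ.v m b (by lia)).hom x)
  rw [Cochain.comp_zero_cochain_v, Cochain.ofHom_v]
  simp only [Units.smul_def, map_zsmul]
  rfl

/-! ### Duality of bounded complexes of finitely generated projective modules -/

lemma cochain_ext_of_concentrated {C : Type*} [Category.{u} C] [Preadditive C]
    {P K : CochainComplex C ℤ} (hK : ∀ i ≠ 0, IsZero (K.X i)) {a m : ℤ} (ham : m + a = 0)
    {φ ψ : Cochain P K a} (h : φ.v m 0 ham = ψ.v m 0 ham) : φ = ψ := by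
  ext i j hij
  by_cases hj : j = 0
  · subst hj
    obtain rfl : i = m := by lia
    exact h
  · exact (hK j hj).eq_of_tgt _ _

variable {K₀ : CochainComplex (ModuleCat.{u} k) ℤ} (hK₀ : ∀ i ≠ 0, IsZero (K₀.X i))
  (e : K₀.X 0 ≅ ModuleCat.of k k)

/-- If `K₀` is the module `k` placed in degree `0`, then `Hom^a(P, K₀)` is the dual
of `P^(-a)`. -/
def cochainEquivDual (P : CochainComplex (ModuleCat.{u} k) ℤ) (a m : ℤ) (ham : m + a = 0) :
    Cochain P K₀ a ≃ₗ[k] Module.Dual k (P.X m) where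
  toFun φ := e.hom.hom ∘ₗ (φ.v m 0 ham).hom
  map_add' φ ψ := by
    ext x
    exact map_add e.hom.hom _ _
  map_smul' c φ := by
    ext x
    exact map_smul e.hom.hom c _
  invFun f := Cochain.single (ModuleCat.ofHom f ≫ e.inv) a
  left_inv φ := by
    refine cochain_ext_of_concentrated (C := ModuleCat.{u} k) hK₀ ham ?_
    rw [Cochain.single_v]
    ext x
    exact congrArg (fun f => f.hom ((φ.v m 0 ham).hom x)) e.hom_inv_id
  right_inv f := by
    ext x
    change e.hom.hom (((Cochain.single (ModuleCat.ofHom f ≫ e.inv) a).v m 0 ham).hom x) = f x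
    rw [Cochain.single_v]
    exact congrArg (fun g => g.hom (f x)) e.inv_hom_id

include hK₀ e in
lemma homCx_isStrictly (P : CochainComplex (ModuleCat.{u} k) ℤ) (a b : ℤ) [P.IsStrictlyGE a]
    [P.IsStrictlyLE b] :
    (homCx k P K₀).IsStrictlyGE (-b) ∧ (homCx k P K₀).IsStrictlyLE (-a) := by
  have h (i : ℤ) (hi : IsZero (P.X (-i))) : IsZero ((homCx k P K₀).X i) := by
    have := ModuleCat.subsingleton_of_isZero hi
    rw [ModuleCat.isZero_iff_subsingleton]
    exact (cochainEquivDual hK₀ e P i (-i) (by lia)).toEquiv.subsingleton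
  refine ⟨?_, ?_⟩
  · rw [CochainComplex.isStrictlyGE_iff]
    exact fun i hi => h i (P.isZero_of_isStrictlyLE b _ (by lia))
  · rw [CochainComplex.isStrictlyLE_iff]
    exact fun i hi => h i (P.isZero_of_isStrictlyGE a _ (by lia))

include hK₀ e in
lemma finite_projective_homCx (P : CochainComplex (ModuleCat.{u} k) ℤ)
    (hP : ∀ i, Module.Finite k (P.X i) ∧ Module.Projective k (P.X i)) (i : ℤ) :
    Module.Finite k ((homCx k P K₀).X i) ∧ Module.Projective k ((homCx k P K₀).X i) := by
  obtain ⟨_, _⟩ := hP (-i)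
  let f := (cochainEquivDual hK₀ e P i (-i) (by lia)).symm
  exact ⟨Module.Finite.equiv f, Module.Projective.of_equiv f⟩

include hK₀ e in
/-- Biduality with values in `k` itself is the reflexivity of finitely generated projective
modules. -/
lemma quasiIso_ev_of_projective (P : CochainComplex (ModuleCat.{u} k) ℤ)
    (hP : ∀ i, Module.Finite k (P.X i) ∧ Module.Projective k (P.X i)) : QuasiIso (ev P K₀) := by
  refine quasiIso_of_bijective _ fun m => ?_
  obtain ⟨_, _⟩ := hP m
  let E := cochainEquivDual hK₀ e P (-m) m (by lia)
  have hE (φ : Cochain P K₀ (-m)) (x : P.X m) :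
      E φ x = e.hom.hom ((φ.v m 0 (by lia)).hom x) := rfl
  have key (x : P.X m) (Φ : Cochain (homCx k P K₀) K₀ m) : evCochain P K₀ m x = Φ ↔
      ∀ φ : Cochain P K₀ (-m), (m * (-m)).negOnePow • E φ x =
        e.hom.hom ((Φ.v (-m) 0 (by lia)).hom φ) := by
    constructor
    · rintro rfl φ
      rw [evCochain_v_apply, hE]
      simp only [Units.smul_def, map_zsmul]
    · intro h
      refine cochain_ext_of_concentrated (C := ModuleCat.{u} k) hK₀
        (show -m + m = 0 by lia) ?_
      refine ModuleCat.hom_ext (LinearMap.ext fun (φ : Cochain P K₀ (-m)) => ?_)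
      apply ((ModuleCat.mono_iff_injective e.hom).1 inferInstance)
      refine Eq.trans ?_ (h φ)
      rw [evCochain_v_apply, hE]
      simp only [Units.smul_def, map_zsmul]
  constructor
  · rw [← LinearMap.ker_eq_bot, LinearMap.ker_eq_bot']
    intro x hx
    rw [← Module.forall_dual_apply_eq_zero_iff k]
    intro f
    obtain ⟨φ, rfl⟩ := E.surjective f
    rw [← smul_eq_zero_iff_eq ((m * (-m)).negOnePow)]
    exact ((key x 0).1 hx φ).trans (map_zero e.hom.hom)
  · intro (Φ : Cochain (homCx k P K₀) K₀ m)
    obtain ⟨x, hx⟩ := (Module.bijective_dual_eval k (P.X m)).2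
      ((e.hom.hom ∘ₗ (Φ.v (-m) 0 (by lia)).hom) ∘ₗ E.symm.toLinearMap)
    refine ⟨(m * (-m)).negOnePow • x, ?_⟩
    refine (key _ Φ).2 fun φ => ?_
    have := LinearMap.congr_fun hx (E φ)
    rw [Units.smul_def, Units.smul_def, map_zsmul, ← Units.smul_def, ← Units.smul_def, smul_smul,
      Int.units_mul_self, one_smul]
    refine this.trans ?_
    change e.hom.hom ((Φ.v (-m) 0 (by lia)).hom (E.symm (E φ))) = _
    rw [E.symm_apply_apply]

variable {J : CochainComplex (ModuleCat.{u} k) ℤ} (g : K₀ ⟶ J)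

include hK₀ e in
/-- Bounded complexes of finitely generated projective modules are reflexive with respect to an
injective resolution `J` of `k`. -/
lemma quasiIso_ev_of_bounded_projective [QuasiIso g] [J.IsKInjective]
    (P : CochainComplex (ModuleCat.{u} k) ℤ) (a b : ℤ) [P.IsStrictlyGE a] [P.IsStrictlyLE b]
    (hP : ∀ i, Module.Finite k (P.X i) ∧ Module.Projective k (P.X i)) : QuasiIso (ev P J) := by
  have h₁ (i : ℤ) : Projective (P.X i) := by
    rw [← IsProjective.iff_projective]
    exact (hP i).2
  have : P.IsKProjective := CochainComplex.isKProjective_of_projective P b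
  obtain ⟨_, _⟩ := homCx_isStrictly hK₀ e P a b
  have h₂ (i : ℤ) : Projective ((homCx k P K₀).X i) := by
    rw [← IsProjective.iff_projective]
    exact (finite_projective_homCx hK₀ e P hP i).2
  have : (homCx k P K₀).IsKProjective := CochainComplex.isKProjective_of_projective _ (-a)
  have := quasiIso_ev_of_projective hK₀ e P hP
  have := quasiIso_homCxPost_of_isKProjective (k := k) P g
  have := quasiIso_homCxPost_of_isKProjective (k := k) (homCx k P K₀) g
  have h := ev_comp_homCxPre_homCxPost P g
  have : QuasiIso (ev P J ≫ homCxPre k (homCxPost k P g) J) := by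
    rw [h]
    infer_instance
  exact quasiIso_of_comp_right _ (homCxPre k (homCxPost k P g) J)

lemma quasiIso_ev_iff [J.IsKInjective] {E E' : CochainComplex (ModuleCat.{u} k) ℤ} (f : E ⟶ E')
    [QuasiIso f] : QuasiIso (ev E J) ↔ QuasiIso (ev E' J) := by
  have : QuasiIso (homCxPre k (homCxPre k f J) J) := inferInstance
  rw [← quasiIso_iff_comp_right (ev E J) (homCxPre k (homCxPre k f J) J), ev_naturality,
    quasiIso_iff_comp_left]

end Biduality

/-! ### Stable classes of complexes of modules -/

section Stable

variable {k : Type u} [CommRing k]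

/-- A class of complexes of `k`-modules which contains the acyclic complexes, is invariant under
quasi-isomorphisms, and contains, with two terms of a short exact sequence of complexes, one of
which is the first, also the third one. -/
structure IsStableClass (W : CochainComplex (ModuleCat.{u} k) ℤ → Prop) : Prop where
  of_acyclic {E : CochainComplex (ModuleCat.{u} k) ℤ} (hE : E.Acyclic) : W E
  iff_of_quasiIso {E E' : CochainComplex (ModuleCat.{u} k) ℤ} (f : E ⟶ E') (hf : QuasiIso f) :
    W E ↔ W E'
  prop_X₂ {S : ShortComplex (CochainComplex (ModuleCat.{u} k) ℤ)} (hS : S.ShortExact)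
    (h₁ : W S.X₁) (h₃ : W S.X₃) : W S.X₂
  prop_X₃ {S : ShortComplex (CochainComplex (ModuleCat.{u} k) ℤ)} (hS : S.ShortExact)
    (h₁ : W S.X₁) (h₂ : W S.X₂) : W S.X₃

/-- Complexes of modules with finitely generated cohomology. -/
def HasFGHomology (E : CochainComplex (ModuleCat.{u} k) ℤ) : Prop :=
  ∀ i, Module.Finite k (E.homology i)

lemma finite_of_exact [IsNoetherianRing k] {S : ShortComplex (ModuleCat.{u} k)} (hS : S.Exact)
    (h₁ : Module.Finite k S.X₁) (h₃ : Module.Finite k S.X₃) : Module.Finite k S.X₂ := by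
  have : IsNoetherian k S.X₁ := isNoetherian_of_isNoetherianRing_of_finite k _
  have : IsNoetherian k S.X₃ := isNoetherian_of_isNoetherianRing_of_finite k _
  have : IsNoetherian k S.X₂ :=
    isNoetherian_of_range_eq_ker S.f.hom S.g.hom hS.moduleCat_range_eq_ker
  infer_instance

lemma finite_of_isZero {M : ModuleCat.{u} k} (hM : IsZero M) : Module.Finite k M := by
  have := ModuleCat.subsingleton_of_isZero hM
  infer_instance

lemma hasFGHomology_isStableClass [IsNoetherianRing k] :
    IsStableClass (HasFGHomology (k := k)) where
  of_acyclic hE i := finite_of_isZero (hE i).isZero_homology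
  iff_of_quasiIso f _ := forall_congr' fun i =>
    ⟨fun _ => Module.Finite.equiv (asIso (HomologicalComplex.homologyMap f i)).toLinearEquiv,
      fun _ => Module.Finite.equiv (asIso (HomologicalComplex.homologyMap f i)).toLinearEquiv.symm⟩
  prop_X₂ hS h₁ h₃ i := finite_of_exact (hS.homology_exact₂ i) (h₁ i) (h₃ i)
  prop_X₃ hS h₁ h₂ i := finite_of_exact (hS.homology_exact₃ i (i + 1) rfl) (h₂ i) (h₁ (i + 1))

/-- Bounded complexes of finitely generated projective modules. -/
def IsBoundedProjective (P : CochainComplex (ModuleCat.{u} k) ℤ) : Prop :=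
  (∃ a b : ℤ, P.IsStrictlyGE a ∧ P.IsStrictlyLE b) ∧
    ∀ i, Module.Finite k (P.X i) ∧ Module.Projective k (P.X i)

lemma IsBoundedProjective.isKProjective {P : CochainComplex (ModuleCat.{u} k) ℤ}
    (hP : IsBoundedProjective P) : P.IsKProjective := by
  obtain ⟨⟨a, b, _, _⟩, h⟩ := hP
  have (i : ℤ) : Projective (P.X i) := by
    rw [← IsProjective.iff_projective]
    exact (h i).2
  exact CochainComplex.isKProjective_of_projective P b

lemma IsBoundedProjective.shift {P : CochainComplex (ModuleCat.{u} k) ℤ}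
    (hP : IsBoundedProjective P) (n : ℤ) : IsBoundedProjective (P⟦n⟧) := by
  obtain ⟨⟨a, b, _, _⟩, h⟩ := hP
  exact ⟨⟨a - n, b - n, P.isStrictlyGE_shift a n _ (by lia), P.isStrictlyLE_shift b n _ (by lia)⟩,
    fun i => h (i + n)⟩

lemma IsBoundedProjective.mappingCone {P P' : CochainComplex (ModuleCat.{u} k) ℤ}
    (hP : IsBoundedProjective P) (hP' : IsBoundedProjective P') (f : P ⟶ P') :
    IsBoundedProjective (CochainComplex.mappingCone f) := by
  obtain ⟨⟨a, b, _, _⟩, h⟩ := hP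
  obtain ⟨⟨a', b', _, _⟩, h'⟩ := hP'
  refine ⟨⟨min a a' - 1, max b b', ?_, ?_⟩, fun i => ?_⟩
  · rw [CochainComplex.isStrictlyGE_iff]
    intro i hi
    rw [CochainComplex.mappingCone.isZero_X_iff]
    exact ⟨P.isZero_of_isStrictlyGE a _ (by lia), P'.isZero_of_isStrictlyGE a' _ (by lia)⟩
  · rw [CochainComplex.isStrictlyLE_iff]
    intro i hi
    rw [CochainComplex.mappingCone.isZero_X_iff]
    exact ⟨P.isZero_of_isStrictlyLE b _ (by lia), P'.isZero_of_isStrictlyLE b' _ (by lia)⟩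
  · obtain ⟨_, _⟩ := h (i + 1)
    obtain ⟨_, _⟩ := h' i
    let e := (HomologicalComplex.homotopyCofiber.XIsoBiprod f i (i + 1) rfl ≪≫
      ModuleCat.biprodIsoProd _ _).toLinearEquiv.symm
    exact ⟨Module.Finite.equiv e, Module.Projective.of_equiv e⟩

section DerivedCategory

variable [HasDerivedCategory.{w} (ModuleCat.{u} k)]

/-- The objects of the derived category that are represented by bounded complexes of finitely
generated projective modules. -/
def IsPerfectObject (X : DerivedCategory (ModuleCat.{u} k)) : Prop :=
  ∃ P : CochainComplex (ModuleCat.{u} k) ℤ, IsBoundedProjective P ∧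
    Nonempty (DerivedCategory.Q.obj P ≅ X)

lemma IsPerfectObject.of_iso {X Y : DerivedCategory (ModuleCat.{u} k)} (hX : IsPerfectObject X)
    (e : X ≅ Y) : IsPerfectObject Y := by
  obtain ⟨P, hP, ⟨e'⟩⟩ := hX
  exact ⟨P, hP, ⟨e' ≪≫ e⟩⟩

/-- Morphisms in the derived category out of a complex of projectives are represented by morphisms
of complexes. -/
lemma exists_Q_map_eq {P E : CochainComplex (ModuleCat.{u} k) ℤ} [P.IsKProjective]
    (f : DerivedCategory.Q.obj P ⟶ DerivedCategory.Q.obj E) :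
    ∃ g : P ⟶ E, DerivedCategory.Q.map g = f := by
  obtain ⟨g, hg⟩ := (CochainComplex.IsKProjective.Qh_map_bijective P
    ((HomotopyCategory.quotient _ _).obj E)).2 ((DerivedCategory.quotientCompQhIso _).hom.app P ≫
      f ≫ (DerivedCategory.quotientCompQhIso _).inv.app E)
  obtain ⟨g, rfl⟩ := (HomotopyCategory.quotient _ _).map_surjective g
  refine ⟨g, ?_⟩
  rw [← cancel_epi ((DerivedCategory.quotientCompQhIso _).hom.app P),
    ← cancel_mono ((DerivedCategory.quotientCompQhIso _).inv.app E), Category.assoc, Category.assoc,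
    ← hg]
  have h := DerivedCategory.quotientCompQhIso_hom_naturality (C := ModuleCat.{u} k) g
  rw [← reassoc_of% h, Iso.hom_inv_id_app]
  exact Category.comp_id _

lemma isPerfect_iff (E : CochainComplex (ModuleCat.{u} k) ℤ) :
    IsPerfect E ↔ IsPerfectObject (DerivedCategory.Q.obj E) := by
  constructor
  · rintro ⟨P, f, _, h, h'⟩
    exact ⟨P, ⟨h, h'⟩, ⟨asIso (DerivedCategory.Q.map f)⟩⟩
  · rintro ⟨P, hP, ⟨e⟩⟩
    have := hP.isKProjective
    obtain ⟨g, hg⟩ := exists_Q_map_eq e.hom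
    refine ⟨P, g, ?_, hP.1, hP.2⟩
    rw [← DerivedCategory.isIso_Q_map_iff_quasiIso, hg]
    infer_instance

lemma IsPerfectObject.shift {X : DerivedCategory (ModuleCat.{u} k)} (hX : IsPerfectObject X)
    (n : ℤ) : IsPerfectObject (X⟦n⟧) := by
  obtain ⟨P, hP, ⟨e⟩⟩ := hX
  exact ⟨P⟦n⟧, hP.shift n,
    ⟨(DerivedCategory.Q.commShiftIso n).app P ≪≫ (shiftFunctor _ n).mapIso e⟩⟩

open Pretriangulated in
lemma IsPerfectObject.obj₃ {T : Triangle (DerivedCategory (ModuleCat.{u} k))}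
    (hT : T ∈ distTriang _) (h₁ : IsPerfectObject T.obj₁) (h₂ : IsPerfectObject T.obj₂) :
    IsPerfectObject T.obj₃ := by
  obtain ⟨P, hP, ⟨e⟩⟩ := h₁
  obtain ⟨P', hP', ⟨e'⟩⟩ := h₂
  have := hP.isKProjective
  obtain ⟨g, hg⟩ := exists_Q_map_eq (e.hom ≫ T.mor₁ ≫ e'.inv)
  refine ⟨CochainComplex.mappingCone g, hP.mappingCone hP' g, ⟨?_⟩⟩
  refine Triangle.π₃.mapIso (isoTriangleOfIso₁₂
    (DerivedCategory.Q.mapTriangle.obj (CochainComplex.mappingCone.triangle g)) T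
    (DerivedCategory.mappingCone_triangle_distinguished g) hT e e' ?_)
  change DerivedCategory.Q.map g ≫ e'.hom = e.hom ≫ T.mor₁
  rw [hg, Category.assoc, Category.assoc, e'.inv_hom_id, Category.comp_id]

end DerivedCategory

attribute [local instance] HasDerivedCategory.standard in
lemma isPerfect_isStableClass : IsStableClass (IsPerfect (k := k)) where
  of_acyclic {E} hE := by
    let Z : CochainComplex (ModuleCat.{u} k) ℤ := HomologicalComplex.zero
    have hZ (i : ℤ) : IsZero (Z.X i) := isZero_zero _
    have hZ' : Z.Acyclic := fun i => (HomologicalComplex.exactAt_iff _ _).2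
      (ShortComplex.exact_of_isZero_X₂ _ (hZ i))
    refine ⟨Z, 0, ?_, ⟨0, 0, ?_, ?_⟩, fun i => ?_⟩
    · rw [quasiIso_iff]
      intro i
      rw [quasiIsoAt_iff_exactAt _ _ (hZ' i)]
      exact hE i
    · rw [CochainComplex.isStrictlyGE_iff]
      exact fun i _ => hZ i
    · rw [CochainComplex.isStrictlyLE_iff]
      exact fun i _ => hZ i
    · have := ModuleCat.subsingleton_of_isZero (hZ i)
      exact ⟨inferInstance, inferInstance⟩
  iff_of_quasiIso f _ := by
    rw [isPerfect_iff, isPerfect_iff]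
    exact ⟨fun h => h.of_iso (asIso (DerivedCategory.Q.map f)),
      fun h => h.of_iso (asIso (DerivedCategory.Q.map f)).symm⟩
  prop_X₂ {S} hS h₁ h₃ := by
    rw [isPerfect_iff] at h₁ h₃ ⊢
    exact IsPerfectObject.obj₃ (Pretriangulated.inv_rot_of_distTriang _
      (DerivedCategory.triangleOfSES_distinguished hS)) (h₃.shift (-1)) h₁
  prop_X₃ {S} hS h₁ h₂ := by
    rw [isPerfect_iff] at h₁ h₂ ⊢
    exact IsPerfectObject.obj₃ (DerivedCategory.triangleOfSES_distinguished hS) h₁ h₂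

/-- For an injective resolution `J` of `k`, the dual `Hom^•(E, J)` of a perfect complex `E` is
perfect, and `E` is reflexive. -/
lemma isPerfect_dual {K₀ J : CochainComplex (ModuleCat.{u} k) ℤ} (hK₀ : ∀ i ≠ 0, IsZero (K₀.X i))
    (e : K₀.X 0 ≅ ModuleCat.of k k) (g : K₀ ⟶ J) [QuasiIso g] [J.IsKInjective]
    {E : CochainComplex (ModuleCat.{u} k) ℤ} (hE : IsPerfect E) :
    IsPerfect (homCx k E J) ∧ QuasiIso (ev E J) := by
  obtain ⟨P, f, _, ⟨a, b, _, _⟩, hP⟩ := hE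
  refine ⟨?_, ?_⟩
  · rw [isPerfect_isStableClass.iff_of_quasiIso (homCxPre k f J) inferInstance]
    have : P.IsKProjective := IsBoundedProjective.isKProjective ⟨⟨a, b, ‹_›, ‹_›⟩, hP⟩
    obtain ⟨h, h'⟩ := homCx_isStrictly hK₀ e P a b
    exact ⟨homCx k P K₀, homCxPost k P g, quasiIso_homCxPost_of_isKProjective P g,
      ⟨_, _, h, h'⟩, finite_projective_homCx hK₀ e P hP⟩
  · rw [← quasiIso_ev_iff f]
    exact quasiIso_ev_of_bounded_projective hK₀ e g P a b hP

end Stable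

/-! ### Bounded injective resolutions -/

section Truncation

variable {C : Type*} [Category* C] [Abelian C] (J : CochainComplex C ℤ)

lemma cycles_shortExact (i j : ℤ) (hij : i + 1 = j) (hj : J.ExactAt j) :
    (ShortComplex.mk (J.iCycles i) (J.toCycles i j) (by
      rw [← cancel_mono (J.iCycles j), Category.assoc, J.toCycles_i, J.iCycles_d,
        zero_comp])).ShortExact := by
  have : Epi (J.toCycles i j) := by
    exact Preadditive.epi_of_isZero_cokernel' _ (J.homologyIsCokernel i j (by simp [← hij]))
      hj.isZero_homology
  refine { exact := ?_, epi_g := this, mono_f := inferInstance }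
  refine ShortComplex.exact_of_f_is_kernel _ ?_
  refine KernelFork.IsLimit.ofι' _ _ fun {A} (x : A ⟶ J.X i) (hx : x ≫ J.toCycles i j = 0) => ?_
  have hx' : x ≫ J.d i j = 0 := by rw [← J.toCycles_i i j, ← Category.assoc, hx, zero_comp]
  exact ⟨J.liftCycles x j (by simp [← hij]) hx', J.liftCycles_i _ _ _ _⟩

lemma hasInjectiveDimensionLT_cycles [J.IsStrictlyGE 0] [J.IsLE 0]
    (hJ : ∀ i, Injective (J.X i)) (N : ℕ)
    [HasInjectiveDimensionLE (J.homology 0) N] (m n : ℕ) (h : m + n = N) :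
    HasInjectiveDimensionLT (J.cycles m) (n + 1) := by
  induction m generalizing n with
  | zero =>
    obtain rfl : n = N := by lia
    exact hasInjectiveDimensionLT_of_iso (J.isoHomologyπ (-1) 0 (by simp)
      ((J.isZero_of_isStrictlyGE 0 (-1)).eq_of_src _ _)).symm _
  | succ m ih =>
    have h₁ := ih (n + 1) (by lia)
    exact ((cycles_shortExact J m (m + 1 : ℕ) (by simp) (J.exactAt_of_isLE 0 _
      (by lia))).hasInjectiveDimensionLT_X₃_iff n (hJ _)).2 h₁

/-- An injective resolution of an object of injective dimension at most `N` may be truncated in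
degree `N`. -/
lemma injective_truncLE_X [J.IsStrictlyGE 0] [J.IsLE 0] (hJ : ∀ i, Injective (J.X i)) (N : ℕ)
    [HasInjectiveDimensionLE (J.homology 0) N] (i : ℤ) : Injective ((J.truncLE N).X i) := by
  obtain h | rfl | h := lt_trichotomy i N
  · exact Injective.of_iso (J.truncLEXIso N i h).symm (hJ i)
  · rw [injective_iff_hasInjectiveDimensionLT_one]
    have := hasInjectiveDimensionLT_cycles J hJ N N 0 (by lia)
    exact hasInjectiveDimensionLT_of_iso (J.truncLEXIsoCycles N).symm _
  · exact ((J.truncLE N).isZero_of_isStrictlyLE N i h).injective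

end Truncation

/-! ### Reflexivity over rings of finite self-injective dimension -/

section FiniteInjectiveDimension

variable {k : Type u} [CommRing k]

lemma homCx_isStrictlyGE {C : Type*} [Category.{u} C] [Preadditive C] [HasZeroObject C] [Linear k C]
    (K L : CochainComplex C ℤ) (b c n : ℤ) (h : c = n + b) [K.IsStrictlyLE b] [L.IsStrictlyGE c] :
    (homCx k K L).IsStrictlyGE n := by
  rw [CochainComplex.isStrictlyGE_iff]
  intro m hm
  refine ModuleCat.isZero_iff_subsingleton.2 ⟨fun (φ : Cochain K L m) (ψ : Cochain K L m) => ?_⟩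
  change φ = ψ
  ext i j hij
  by_cases hi : b < i
  · exact (K.isZero_of_isStrictlyLE b i).eq_of_src _ _
  · exact (L.isZero_of_isStrictlyGE c j).eq_of_tgt _ _

lemma homCx_isStrictlyLE {C : Type*} [Category.{u} C] [Preadditive C] [HasZeroObject C] [Linear k C]
    (K L : CochainComplex C ℤ) (a c n : ℤ) (h : c = n + a) [K.IsStrictlyGE a] [L.IsStrictlyLE c] :
    (homCx k K L).IsStrictlyLE n := by
  rw [CochainComplex.isStrictlyLE_iff]
  intro m hm
  refine ModuleCat.isZero_iff_subsingleton.2 ⟨fun (φ : Cochain K L m) (ψ : Cochain K L m) => ?_⟩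
  change φ = ψ
  ext i j hij
  by_cases hi : i < a
  · exact (K.isZero_of_isStrictlyGE a i).eq_of_src _ _
  · exact (L.isZero_of_isStrictlyLE c j).eq_of_tgt _ _

lemma isGE_of_quasiIso {C : Type*} [Category* C] [Abelian C] {K L : CochainComplex C ℤ} (f : K ⟶ L)
    [QuasiIso f] (n : ℤ) : K.IsGE n ↔ L.IsGE n := by
  simp only [CochainComplex.isGE_iff, exactAt_iff_of_quasiIsoAt f]

lemma isLE_of_quasiIso {C : Type*} [Category* C] [Abelian C] {K L : CochainComplex C ℤ} (f : K ⟶ L)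
    [QuasiIso f] (n : ℤ) : K.IsLE n ↔ L.IsLE n := by
  simp only [CochainComplex.isLE_iff, exactAt_iff_of_quasiIsoAt f]

lemma homCx_isGE {C : Type*} [Category.{u} C] [Abelian C] [Linear k C] (E J : CochainComplex C ℤ)
    [J.IsKInjective] [J.IsStrictlyGE 0] (b n : ℤ) (h : n + b = 0) [E.IsLE b] :
    (homCx k E J).IsGE n := by
  rw [isGE_of_quasiIso (homCxPre k (E.ιTruncLE b) J)]
  have := homCx_isStrictlyGE (k := k) (E.truncLE b) J b 0 n h.symm
  infer_instance

lemma homCx_isLE {C : Type*} [Category.{u} C] [Abelian C] [Linear k C] (E J : CochainComplex C ℤ)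
    [J.IsKInjective] [J.IsStrictlyGE 0] [J.IsLE 0] (hJ : ∀ i, Injective (J.X i)) (N : ℕ)
    [HasInjectiveDimensionLE (J.homology 0) N] (a n : ℤ) (h : n + a = N) [E.IsGE a] :
    (homCx k E J).IsLE n := by
  have : J.IsLE N := J.isLE_of_le 0 N (by lia)
  have := quasiIso_homCxPost_of_injective (k := k) (E.truncGE a) (J.ιTruncLE N) 0
    (injective_truncLE_X J hJ N) hJ
  rw [← isLE_of_quasiIso (homCxPre k (E.πTruncGE a) J),
    ← isLE_of_quasiIso (homCxPost k (E.truncGE a) (J.ιTruncLE N))]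
  have := homCx_isStrictlyLE (k := k) (E.truncGE a) (J.truncLE N) a N n h.symm
  infer_instance

lemma IsPerfect.hasFGHomology [IsNoetherianRing k] {E : CochainComplex (ModuleCat.{u} k) ℤ}
    (hE : IsPerfect E) : HasFGHomology E := by
  obtain ⟨P, f, hf, -, hP⟩ := hE
  rw [← hasFGHomology_isStableClass.iff_of_quasiIso f hf]
  intro i
  have := (hP i).1
  have : Module.Finite k (P.cycles i) :=
    Module.Finite.of_injective (P.iCycles i).hom (iCycles_injective P i)
  exact Module.Finite.of_surjective (P.homologyπ i).hom (homologyπ_surjective P i)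

/-- The top cohomology of a complex with finitely generated cohomology may be killed by the mapping
cone of a morphism out of a finitely generated free module. -/
lemma exists_shortExact_of_hasFGHomology [IsNoetherianRing k]
    {E : CochainComplex (ModuleCat.{u} k) ℤ} (hE : HasFGHomology E) (b : ℤ) [E.IsLE b] :
    ∃ (Q T : CochainComplex (ModuleCat.{u} k) ℤ) (f : E ⟶ Q) (g : Q ⟶ T) (w : f ≫ g = 0),
      (ShortComplex.mk f g w).ShortExact ∧ HasFGHomology Q ∧ Q.IsLE (b - 1) ∧ IsPerfect T := by
  have := hE b
  obtain ⟨r, π, hπ⟩ := Module.Finite.exists_fin' k (E.homology b)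
  let A := ModuleCat.of.{u} k (Fin r → k)
  have : Projective A := (IsProjective.iff_projective _).1 (inferInstance : Module.Projective k _)
  let π' : A ⟶ E.homology b := ModuleCat.ofHom π
  have : Epi π' := (ModuleCat.epi_iff_surjective _).2 hπ
  let φ : A ⟶ E.cycles b := Projective.factorThru π' (E.homologyπ b)
  have hφ : φ ≫ E.homologyπ b = π' := Projective.factorThru_comp _ _
  let L : CochainComplex (ModuleCat.{u} k) ℤ :=
    (HomologicalComplex.single (ModuleCat.{u} k) (ComplexShape.up ℤ) b).obj A
  let f : L ⟶ E := HomologicalComplex.mkHomFromSingle (φ ≫ E.iCycles b) (by simp)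
  have hL : IsBoundedProjective L := by
    refine ⟨⟨b, b, inferInstance, inferInstance⟩, fun i => ?_⟩
    by_cases hi : i = b
    · let e' :=
        (HomologicalComplex.singleObjXIsoOfEq (ComplexShape.up ℤ) b A i hi).toLinearEquiv.symm
      exact ⟨Module.Finite.equiv e', Module.Projective.of_equiv e'⟩
    · have := ModuleCat.subsingleton_of_isZero
        (HomologicalComplex.isZero_single_obj_X (ComplexShape.up ℤ) b A i hi)
      exact ⟨inferInstance, inferInstance⟩
  have : L.IsStrictlyLE b := by infer_instance
  have : (L⟦(1 : ℤ)⟧).IsStrictlyLE (b - 1) := L.isStrictlyLE_shift b 1 _ (by lia)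
  have hS := mappingCone_shortExact f
  have hT : IsPerfect (L⟦(1 : ℤ)⟧) := ⟨_, 𝟙 _, inferInstance, (hL.shift 1).1, (hL.shift 1).2⟩
  refine ⟨_, _, _, _, _, hS, hasFGHomology_isStableClass.prop_X₂ hS hE hT.hasFGHomology, ?_, hT⟩
  have hf : Epi (HomologicalComplex.homologyMap f b) := by
    have : IsIso (L.iCycles b) := L.isIso_iCycles b (b + 1) (by simp) (by simp [L])
    have h₁ : HomologicalComplex.cyclesMap f b = L.iCycles b ≫
        (HomologicalComplex.singleObjXSelf (ComplexShape.up ℤ) b A).hom ≫ φ := by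
      rw [← cancel_mono (E.iCycles b), HomologicalComplex.cyclesMap_i,
        HomologicalComplex.mkHomFromSingle_f]
      simp
    have h₂ : L.homologyπ b ≫ HomologicalComplex.homologyMap f b = L.iCycles b ≫
        (HomologicalComplex.singleObjXSelf (ComplexShape.up ℤ) b A).hom ≫ π' := by
      rw [HomologicalComplex.homologyπ_naturality, h₁, Category.assoc, Category.assoc, hφ]
    exact epi_of_epi_fac h₂
  have hf' : HomologicalComplex.homologyMap f b ≫
      HomologicalComplex.homologyMap (CochainComplex.mappingCone.inr f) b = 0 := by
    rw [← HomologicalComplex.homologyMap_comp]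
    exact ((HomologicalComplex.homotopyCofiber.inrCompHomotopy f
      (fun j => ⟨j - 1, by simp⟩)).homologyMap_eq b).trans
        (HomologicalComplex.homologyMap_zero _ _ _)
  rw [CochainComplex.isLE_iff]
  intro i hi
  have h₀ : HomologicalComplex.homologyMap (CochainComplex.mappingCone.inr f) i = 0 := by
    by_cases h : i = b
    · subst h
      rw [← cancel_epi (HomologicalComplex.homologyMap f i), hf', comp_zero]
    · exact (E.exactAt_of_isLE b i).isZero_homology.eq_of_src _ _
  rw [HomologicalComplex.exactAt_iff_isZero_homology]
  exact (hS.homology_exact₂ i).isZero_X₂_iff.2 ⟨h₀,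
    ((L⟦(1 : ℤ)⟧).exactAt_of_isLE (b - 1) i (by lia)).isZero_homology.eq_of_tgt _ _⟩

/-- The biduality morphism of a short complex. -/
def evShortComplex (S : ShortComplex (CochainComplex (ModuleCat.{u} k) ℤ))
    (J : CochainComplex (ModuleCat.{u} k) ℤ) :
    S ⟶ ShortComplex.mk (homCxPre k (homCxPre k S.f J) J) (homCxPre k (homCxPre k S.g J) J)
      (by rw [← homCxPre_comp, ← homCxPre_comp, S.zero, homCxPre_zero, homCxPre_zero]) where
  τ₁ := ev S.X₁ J
  τ₂ := ev S.X₂ J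
  τ₃ := ev S.X₃ J
  comm₁₂ := ev_naturality S.f J
  comm₂₃ := ev_naturality S.g J

lemma bidual_shortExact {S : ShortComplex (CochainComplex (ModuleCat.{u} k) ℤ)} (hS : S.ShortExact)
    (J : CochainComplex (ModuleCat.{u} k) ℤ) (hJ : ∀ i, Injective (J.X i)) :
    (ShortComplex.mk (homCxPre k (homCxPre k S.f J) J) (homCxPre k (homCxPre k S.g J) J)
      (by rw [← homCxPre_comp, ← homCxPre_comp, S.zero, homCxPre_zero,
        homCxPre_zero])).ShortExact :=
  homCx_shortExact (homCx_shortExact hS J hJ) J hJ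

lemma isLE_zero_of_quasiIso {C : Type*} [Category* C] [Abelian C] {K₀ J : CochainComplex C ℤ}
    (hK₀ : ∀ i ≠ 0, IsZero (K₀.X i)) (g : K₀ ⟶ J) [QuasiIso g] : J.IsLE 0 := by
  have : K₀.IsStrictlyLE 0 := by
    rw [CochainComplex.isStrictlyLE_iff]
    exact fun i hi => hK₀ i hi.ne'
  rw [← isLE_of_quasiIso g]
  infer_instance

lemma hasInjectiveDimensionLE_homology {C : Type*} [Category* C] [Abelian C] {A : C}
    {K₀ J : CochainComplex C ℤ} (hK₀ : ∀ i ≠ 0, IsZero (K₀.X i)) (e : K₀.X 0 ≅ A) (g : K₀ ⟶ J)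
    [QuasiIso g] (N : ℕ) [HasInjectiveDimensionLE A N] :
    HasInjectiveDimensionLE (J.homology 0) N := by
  let e₁ : K₀.homology 0 ≅ K₀.X 0 := (K₀.isoHomologyπ (-1) 0 (by simp)
    ((hK₀ (-1) (by simp)).eq_of_src _ _)).symm ≪≫ (K₀.iCyclesIso 0 1 (by simp)
      ((hK₀ 1 (by simp)).eq_of_tgt _ _))
  let e₂ := (asIso (HomologicalComplex.homologyMap g 0)).symm ≪≫ e₁ ≪≫ e
  exact hasInjectiveDimensionLT_of_iso e₂.symm _

lemma HasFGHomology.truncLE {E : CochainComplex (ModuleCat.{u} k) ℤ} (hE : HasFGHomology E)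
    (b : ℤ) : HasFGHomology (E.truncLE b) := by
  intro i
  by_cases hi : i ≤ b
  · have := E.quasiIsoAt_ιTruncLE b i hi
    have := hE i
    exact Module.Finite.equiv
      (asIso (HomologicalComplex.homologyMap (E.ιTruncLE b) i)).symm.toLinearEquiv
  · exact finite_of_isZero ((E.truncLE b).exactAt_of_isLE b i).isZero_homology

lemma isGE_shortComplexTruncLE_X₃ {C : Type*} [Category* C] [Abelian C] (E : CochainComplex C ℤ)
    (b : ℤ) : (E.shortComplexTruncLE b).X₃.IsGE (b + 1) := by
  rw [isGE_of_quasiIso (E.shortComplexTruncLEX₃ToTruncGE b (b + 1) rfl)]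
  infer_instance

variable [IsNoetherianRing k] {K₀ J : CochainComplex (ModuleCat.{u} k) ℤ}

/-- For a complex with cohomology in degrees `≤ b`, the cohomology of the dual vanishes in degrees
`< -b`; each time the top cohomology is killed, the range in which it is finitely generated grows by
one. -/
lemma finite_homology_homCx_of_isLE (hK₀ : ∀ i ≠ 0, IsZero (K₀.X i)) (e : K₀.X 0 ≅ ModuleCat.of k k)
    (g : K₀ ⟶ J) [QuasiIso g] [J.IsStrictlyGE 0] (hJ : ∀ i, Injective (J.X i)) (m : ℕ)
    (E : CochainComplex (ModuleCat.{u} k) ℤ) (hE : HasFGHomology E) (b i : ℤ) [E.IsLE b]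
    (hi : i < -b + m) : Module.Finite k ((homCx k E J).homology i) := by
  have := CochainComplex.isKInjective_of_injective J 0
  induction m generalizing E b i with
  | zero =>
    have := homCx_isGE (k := k) E J b (-b) (by lia)
    exact finite_of_isZero ((homCx k E J).exactAt_of_isGE (-b) i (by lia)).isZero_homology
  | succ m ih =>
    obtain ⟨Q, T, f, f', w, hS, hQ, _, hT⟩ := exists_shortExact_of_hasFGHomology hE b
    have h₁ := ih Q hQ (b - 1) i (by lia)
    have h₂ := (isPerfect_dual hK₀ e g hT).1.hasFGHomology (i + 1)
    exact finite_of_exact ((homCx_shortExact hS J hJ).homology_exact₃ i (i + 1) rfl) h₁ h₂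

/-- The dual of a complex with finitely generated cohomology has finitely generated cohomology. -/
lemma hasFGHomology_homCx (hK₀ : ∀ i ≠ 0, IsZero (K₀.X i)) (e : K₀.X 0 ≅ ModuleCat.of k k)
    (g : K₀ ⟶ J) [QuasiIso g] [J.IsStrictlyGE 0] (hJ : ∀ i, Injective (J.X i)) (N : ℕ)
    [HasInjectiveDimensionLE (ModuleCat.of k k) N] {E : CochainComplex (ModuleCat.{u} k) ℤ}
    (hE : HasFGHomology E) : HasFGHomology (homCx k E J) := by
  have := CochainComplex.isKInjective_of_injective J 0
  have := isLE_zero_of_quasiIso hK₀ g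
  have := hasInjectiveDimensionLE_homology hK₀ e g N
  intro i
  -- The part of `E` above degree `N - i` does not contribute to the cohomology of the dual in
  -- degree `i`.
  let b : ℤ := N - i
  have hS := E.shortComplexTruncLE_shortExact b
  have := isGE_shortComplexTruncLE_X₃ E b
  have := homCx_isLE (k := k) (E.shortComplexTruncLE b).X₃ J hJ N (b + 1) (i - 1) (by lia)
  exact finite_of_exact ((homCx_shortExact hS J hJ).homology_exact₂ i)
    (finite_of_isZero ((homCx k _ J).exactAt_of_isLE (i - 1) i).isZero_homology)
    (finite_homology_homCx_of_isLE hK₀ e g hJ (i + b + 1).toNat _ (hE.truncLE b) b i (by lia))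

lemma mono_epi_homologyMap_of_isZero {C : Type*} [Category* C] [Abelian C]
    {A B : CochainComplex C ℤ} (f : A ⟶ B) (i : ℤ) (hA : A.ExactAt i) (hB : B.ExactAt i) :
    Mono (HomologicalComplex.homologyMap f i) ∧ Epi (HomologicalComplex.homologyMap f i) :=
  ⟨⟨fun _ _ _ => hA.isZero_homology.eq_of_tgt _ _⟩,
    ⟨fun _ _ _ => hB.isZero_homology.eq_of_src _ _⟩⟩

/-- For a complex with cohomology in degrees `≤ b`, the bidual has no cohomology in degrees
`> N + b`; each time the top cohomology is killed, the range in which biduality is injective or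
surjective on cohomology grows by one. -/
lemma homologyMap_ev_of_isLE (hK₀ : ∀ i ≠ 0, IsZero (K₀.X i)) (e : K₀.X 0 ≅ ModuleCat.of k k)
    (g : K₀ ⟶ J) [QuasiIso g] [J.IsStrictlyGE 0] (hJ : ∀ i, Injective (J.X i)) (N : ℕ)
    [HasInjectiveDimensionLE (ModuleCat.of k k) N] (m : ℕ)
    (E : CochainComplex (ModuleCat.{u} k) ℤ) (hE : HasFGHomology E) (b : ℤ) [E.IsLE b] (i : ℤ) :
    (N + b + 1 - m < i → Mono (HomologicalComplex.homologyMap (ev E J) i)) ∧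
      (N + b + 1 - m ≤ i → Epi (HomologicalComplex.homologyMap (ev E J) i)) := by
  have := CochainComplex.isKInjective_of_injective J 0
  have := isLE_zero_of_quasiIso hK₀ g
  have := hasInjectiveDimensionLE_homology hK₀ e g N
  induction m generalizing E b i with
  | zero =>
    have := homCx_isGE (k := k) E J b (-b) (by lia)
    have := homCx_isLE (k := k) (homCx k E J) J hJ N (-b) (N + b) (by lia)
    have h (hi : N + b + 1 ≤ i) := mono_epi_homologyMap_of_isZero (ev E J) i
      (E.exactAt_of_isLE b i) ((homCx k (homCx k E J) J).exactAt_of_isLE (N + b) i)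
    exact ⟨fun hi => (h (by lia)).1, fun hi => (h (by lia)).2⟩
  | succ m ih =>
    obtain ⟨Q, T, f, f', w, hS, hQ, _, hT⟩ := exists_shortExact_of_hasFGHomology hE b
    have h₂ := ih Q hQ (b - 1)
    have h₃ : QuasiIso (ev T J) := (isPerfect_dual hK₀ e g hT).2
    have h₃' (j : ℤ) : IsIso (HomologicalComplex.homologyMap (ev T J) j) := inferInstance
    exact ⟨fun hi => mono_homologyMap_τ₁ (evShortComplex (.mk f f' w) J) hS
        (bidual_shortExact hS J hJ) (i - 1) i (by lia) ((h₂ (i - 1)).2 (by lia))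
        (h₃' (i - 1)).mono_of_iso ((h₂ i).1 (by lia)),
      fun hi => epi_homologyMap_τ₁ (evShortComplex (.mk f f' w) J) hS
        (bidual_shortExact hS J hJ) (i - 1) i (by lia) (h₃' (i - 1)).epi_of_iso
        ((h₂ i).2 (by lia)) (h₃' i).mono_of_iso⟩

/-- If `k` is noetherian and has finite injective dimension over itself, then complexes with
finitely generated cohomology are reflexive. -/
lemma quasiIso_ev_of_hasFGHomology (hK₀ : ∀ i ≠ 0, IsZero (K₀.X i))
    (e : K₀.X 0 ≅ ModuleCat.of k k) (g : K₀ ⟶ J) [QuasiIso g] [J.IsStrictlyGE 0]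
    (hJ : ∀ i, Injective (J.X i)) (N : ℕ) [HasInjectiveDimensionLE (ModuleCat.of k k) N]
    {E : CochainComplex (ModuleCat.{u} k) ℤ} (hE : HasFGHomology E) : QuasiIso (ev E J) := by
  have := CochainComplex.isKInjective_of_injective J 0
  have := isLE_zero_of_quasiIso hK₀ g
  have := hasInjectiveDimensionLE_homology hK₀ e g N
  rw [quasiIso_iff]
  intro i
  rw [quasiIsoAt_iff_isIso_homologyMap]
  -- The part of `E` above degree `i + N + 1`, and its bidual, have no cohomology in the degrees
  -- up to `i + 1`.
  let b : ℤ := N + i + 1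
  have hS := E.shortComplexTruncLE_shortExact b
  have h₁ (j : ℤ) := homologyMap_ev_of_isLE hK₀ e g hJ N (N + b + 1 - i + 1).toNat _
    (hE.truncLE b) b j
  have := isGE_shortComplexTruncLE_X₃ E b
  have := homCx_isLE (k := k) (E.shortComplexTruncLE b).X₃ J hJ N (b + 1) (N - (b + 1)) (by lia)
  have := homCx_isGE (k := k) (homCx k (E.shortComplexTruncLE b).X₃ J) J (N - (b + 1))
    (b + 1 - N) (by lia)
  have h₃ (j : ℤ) (hj : j ≤ i) := mono_epi_homologyMap_of_isZero (ev (E.shortComplexTruncLE b).X₃ J)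
    j (CochainComplex.exactAt_of_isGE _ (b + 1) j) (CochainComplex.exactAt_of_isGE _ (b + 1 - N) j)
  have : Mono (HomologicalComplex.homologyMap (ev E J) i) :=
    mono_homologyMap_τ₂ (evShortComplex _ J) hS (bidual_shortExact hS J hJ) (i - 1) i (by lia)
    (h₃ (i - 1) (by lia)).2 ((h₁ i).1 (by lia)) (h₃ i le_rfl).1
  have : Epi (HomologicalComplex.homologyMap (ev E J) i) :=
    epi_homologyMap_τ₂ (evShortComplex _ J) hS (bidual_shortExact hS J hJ) i (i + 1) rfl
    ((h₁ i).2 (by lia)) (h₃ i le_rfl).2 ((h₁ (i + 1)).1 (by lia))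
  exact isIso_of_mono_of_epi _

end FiniteInjectiveDimension

/-! ### Injective dimension of Gorenstein rings -/

section Bass

open Abelian IsLocalRing

variable {R : Type u} [CommRing R]

/-- A higher version of Baer's criterion: the injective dimension can be tested against finitely
generated modules. -/
lemma hasInjectiveDimensionLE_of_forall_finite (n : ℕ) (X : ModuleCat.{u} R)
    (h : ∀ M : ModuleCat.{u} R, Module.Finite R M → Subsingleton (Ext M X (n + 1))) :
    HasInjectiveDimensionLE X n := by
  induction n generalizing X with
  | zero =>
    rw [HasInjectiveDimensionLE, zero_add, ← injective_iff_hasInjectiveDimensionLT_one,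
      ← Module.injective_iff_injective_object, ← Module.Baer.iff_injective]
    intro I f
    have hS : (ShortComplex.mk (ModuleCat.ofHom I.subtype) (ModuleCat.ofHom I.mkQ)
        (ModuleCat.hom_ext (LinearMap.ext fun x =>
          Ideal.Quotient.eq_zero_iff_mem.2 x.2))).ShortExact :=
      ModuleCat.shortComplex_shortExact _ (LinearMap.exact_subtype_mkQ I) I.injective_subtype
        I.mkQ_surjective
    have := h (ModuleCat.of R (R ⧸ I)) inferInstance
    obtain ⟨y, hy⟩ := Ext.contravariant_sequence_exact₁ hS X (Ext.mk₀ (ModuleCat.ofHom f))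
      (add_zero 1) (Subsingleton.elim _ _)
    obtain ⟨g, rfl⟩ := (Ext.mk₀_bijective _ _).2 y
    rw [Ext.mk₀_comp_mk₀, (Ext.mk₀_bijective _ _).1.eq_iff] at hy
    exact ⟨g.hom, fun x hx => congrArg (fun l => l.hom (⟨x, hx⟩ : I)) hy⟩
  | succ n ih =>
    have hS : (ShortComplex.mk (Injective.ι X) (cokernel.π _)
        (cokernel.condition (Injective.ι X))).ShortExact :=
      { exact := ShortComplex.exact_cokernel _ }
    rw [HasInjectiveDimensionLE, ← hS.hasInjectiveDimensionLT_X₃_iff n inferInstance]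
    refine ih _ fun M hM => ⟨fun x y => ?_⟩
    have := h M hM
    have h₀ (z : Ext M (cokernel (Injective.ι X)) (n + 1)) : z = 0 := by
      obtain ⟨y, rfl⟩ := Ext.covariant_sequence_exact₃ M hS z rfl (Subsingleton.elim _ _)
      rw [y.eq_zero_of_injective, Ext.zero_comp]
    rw [h₀ x, h₀ y]

/-- A finitely generated module whose residue field does not embed into it has a regular element
in the maximal ideal. -/
lemma exists_isSMulRegular [IsLocalRing R] [IsNoetherianRing R] (M : Type u) [AddCommGroup M]
    [Module R M] [Module.Finite R M]
    (h : ¬ ∃ f : R ⧸ maximalIdeal R →ₗ[R] M, Function.Injective f) :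
    ∃ x ∈ maximalIdeal R, IsSMulRegular M x := by
  by_contra! h'
  apply h
  have h₀ : (maximalIdeal R : Set R) ⊆ ⋃ p ∈ associatedPrimes R M, p := by
    rw [biUnion_associatedPrimes_eq_zero_divisors]
    intro x hx
    have := h' x hx
    rw [isSMulRegular_iff_right_eq_zero_of_smul] at this
    push Not at this
    exact this.imp fun m hm => ⟨hm.2, hm.1⟩
  obtain ⟨P, hP, hP'⟩ := ((maximalIdeal R).subset_union_prime_finite (associatedPrimes.finite R M)
    (f := id) 0 0 fun _ h _ _ => h.1).1 h₀
  obtain rfl : maximalIdeal R = P := (maximalIdeal.isMaximal R).eq_of_le hP.1.ne_top hP'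
  exact ((isAssociatedPrime_iff_exists_injective_linearMap _ M).1 hP).2

/-- Killing regular elements, the residue field is embedded into a module of finite projective
dimension. -/
lemma exists_injective_residueField [IsLocalRing R] [IsNoetherianRing R] (d p : ℕ)
    (M : ModuleCat.{u} R) [Module.Finite R M] [Nontrivial M] (hd : Module.supportDim R M ≤ d)
    (hp : projectiveDimension M ≤ p) :
    ∃ M' : ModuleCat.{u} R, projectiveDimension M' ≤ (p + d : ℕ) ∧
      ∃ f : R ⧸ maximalIdeal R →ₗ[R] M', Function.Injective f := by
  induction d generalizing M p with
  | zero =>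
    by_cases h : ∃ f : R ⧸ maximalIdeal R →ₗ[R] M, Function.Injective f
    · exact ⟨M, hp, h⟩
    · obtain ⟨x, hx, hx'⟩ := exists_isSMulRegular M h
      have h₁ := Module.supportDim_quotSMulTop_succ_eq_supportDim hx' hx
      have := nontrivial_quotSMulTop_of_mem_maximalIdeal M hx
      have h₂ := Module.supportDim_ne_bot_of_nontrivial R (QuotSMulTop x M)
      rw [← h₁] at hd
      exact absurd ((ENat.WithBot.add_one_le_zero_iff _).1 (by exact_mod_cast hd)) h₂
  | succ d ih =>
    by_cases h : ∃ f : R ⧸ maximalIdeal R →ₗ[R] M, Function.Injective f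
    · exact ⟨M, hp.trans (by exact_mod_cast (by lia)), h⟩
    · obtain ⟨x, hx, hx'⟩ := exists_isSMulRegular M h
      have h₁ := Module.supportDim_quotSMulTop_succ_eq_supportDim hx' hx
      have := nontrivial_quotSMulTop_of_mem_maximalIdeal M hx
      obtain ⟨M', hM', hM''⟩ := ih (p + 1) (ModuleCat.of R (QuotSMulTop x M)) (by
        rw [← h₁] at hd
        exact ENat.WithBot.add_le_add_one_right_iff.1 (by exact_mod_cast hd)) (by
        rw [ModuleCat.projectiveDimension_quotSMulTop_eq_succ_of_isSMulRegular M x hx' hx]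
        push_cast
        gcongr)
      exact ⟨M', by rwa [show p + (d + 1) = p + 1 + d by lia], hM''⟩

lemma subsingleton_ext_of_iso {A B : ModuleCat.{u} R} (e : A ≅ B) (X : ModuleCat.{u} R) (n : ℕ)
    (h : Subsingleton (Ext B X n)) : Subsingleton (Ext A X n) := by
  refine ⟨fun x y => ?_⟩
  have h (z : Ext A X n) : z = 0 := by
    rw [← Ext.mk₀_id_comp z, ← e.hom_inv_id, ← Ext.mk₀_comp_mk₀,
      Ext.comp_assoc_of_second_deg_zero, Subsingleton.elim ((Ext.mk₀ e.inv).comp z _) 0,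
      Ext.comp_zero]
  rw [h x, h y]

/-- If `Ext^n(κ, X) = 0` for the residue field `κ`, and `Ext^i(-, X) = 0` for `i > n`, then
`Ext^n(-, X)` vanishes on finitely generated modules. -/
lemma subsingleton_ext_of_residueField [IsLocalRing R] [IsNoetherianRing R] (X : ModuleCat.{u} R)
    [Module.Finite R X] (n : ℕ) [HasInjectiveDimensionLE X n]
    (h : Subsingleton (Ext (ModuleCat.of R (R ⧸ maximalIdeal R)) X n)) (M : ModuleCat.{u} R)
    (hM : Module.Finite R M) : Subsingleton (Ext M X n) := by
  refine IsNoetherianRing.induction_on_isQuotientEquivQuotientPrime (A := R) hM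
    (motive := fun N _ _ _ => Subsingleton (Ext (ModuleCat.of R N) X n)) ?_ ?_ ?_
  · intro N _ _ _ _
    have := (ModuleCat.isZero_iff_subsingleton (M := ModuleCat.of R N)).2 ‹_›
    have h₀ (z : Ext (ModuleCat.of R N) X n) : z = 0 := by
      rw [← Ext.mk₀_id_comp z, this.eq_of_src (𝟙 _) 0, Ext.mk₀_zero, Ext.zero_comp]
    exact ⟨fun x y => by rw [h₀ x, h₀ y]⟩
  · intro N _ _ _ p e
    by_cases hp : p.1 = maximalIdeal R
    · rw [hp] at e
      exact subsingleton_ext_of_iso e.toModuleIso X n h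
    · obtain ⟨x, hx, hx'⟩ : ∃ x ∈ maximalIdeal R, x ∉ p.1 := by
        by_contra! h'
        exact hp ((maximalIdeal.isMaximal R).eq_of_le p.2.ne_top h').symm
      have hreg : IsSMulRegular N x := by
        rw [isSMulRegular_iff_right_eq_zero_of_smul]
        intro m hm
        obtain ⟨a, ha⟩ := Ideal.Quotient.mk_surjective (e m)
        have h' : Ideal.Quotient.mk p.1 (x * a) = 0 := by
          have := congrArg e hm
          rwa [map_smul, ← ha, map_zero] at this
        rw [Ideal.Quotient.eq_zero_iff_mem] at h'
        rw [← e.map_eq_zero_iff, ← ha, Ideal.Quotient.eq_zero_iff_mem]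
        exact (p.2.mem_or_mem h').resolve_left hx'
      have hS := IsSMulRegular.smulShortComplex_shortExact (M := ModuleCat.of R N) hreg
      -- Multiplication by `x` is surjective on `Ext^n(N, X)`, as `Ext^(n + 1)(N / x N, X) = 0`.
      have h₁ (z : Ext (ModuleCat.of R N) X n) : ∃ y, x • y = z := by
        obtain ⟨(y : Ext (ModuleCat.of R N) X n),
            (hy : (Ext.mk₀ (x • 𝟙 (ModuleCat.of R N))).comp y (zero_add n) = z)⟩ :=
          Ext.contravariant_sequence_exact₁ hS X z (add_comm 1 n)
            (Ext.eq_zero_of_hasInjectiveDimensionLT _ (n + 1) le_rfl)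
        exact ⟨y, by rw [← hy, Ext.mk₀_smul, Ext.smul_comp, Ext.mk₀_id_comp]⟩
      have h₂ : (⊤ : Submodule R (Ext (ModuleCat.of R N) X n)) = ⊥ := by
        refine Submodule.eq_bot_of_le_smul_of_le_jacobson_bot (maximalIdeal R) ⊤
          Module.Finite.fg_top
          (fun z _ => ?_) (IsLocalRing.maximalIdeal_le_jacobson _)
        obtain ⟨y, rfl⟩ := h₁ z
        exact Submodule.smul_mem_smul hx trivial
      exact (Submodule.subsingleton_iff R).1 (subsingleton_of_bot_eq_top h₂.symm)
  · intro N₁ _ _ _ N₂ _ _ _ N₃ _ _ _ f g hf hg hfg h₁ h₃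
    have hS : (ShortComplex.mk (ModuleCat.ofHom f) (ModuleCat.ofHom g)
        (ModuleCat.hom_ext hfg.linearMap_comp_eq_zero)).ShortExact :=
      ModuleCat.shortComplex_shortExact _ hfg hf hg
    have h₀ (z : Ext (ModuleCat.of R N₂) X n) : z = 0 := by
      obtain ⟨y, rfl⟩ := Ext.contravariant_sequence_exact₂ hS X z (Subsingleton.elim _ _)
      rw [Subsingleton.elim y 0, Ext.comp_zero]
    exact ⟨fun x y => by rw [h₀ x, h₀ y]⟩

/-- The injective dimension of a local ring, if finite, is at most the Krull dimension. -/
lemma hasInjectiveDimensionLE_self_of_isLocalRing [IsLocalRing R] [IsNoetherianRing R] (d n : ℕ)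
    (hd : ringKrullDim R ≤ d) (h : HasInjectiveDimensionLE (ModuleCat.of R R) (d + n)) :
    HasInjectiveDimensionLE (ModuleCat.of R R) d := by
  induction n with
  | zero => exact h
  | succ n ih =>
    apply ih
    refine hasInjectiveDimensionLE_of_forall_finite _ _ fun M hM =>
      subsingleton_ext_of_residueField (ModuleCat.of R R) (d + n + 1) ?_ M hM
    -- The residue field is a submodule of a module `M'` of projective dimension at most `d`.
    obtain ⟨M', hM', f, hf⟩ := exists_injective_residueField d 0 (ModuleCat.of R R)
      (by rwa [Module.supportDim_self_eq_ringKrullDim]) (by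
        rw [projectiveDimension_le_iff]; infer_instance)
    rw [projectiveDimension_le_iff, zero_add] at hM'
    have : Mono (ModuleCat.ofHom f) := (ModuleCat.mono_iff_injective _).2 hf
    have hS : (ShortComplex.mk (ModuleCat.ofHom f) (cokernel.π _)
        (cokernel.condition (ModuleCat.ofHom f))).ShortExact :=
      { exact := ShortComplex.exact_cokernel _ }
    have h₀ (z : Ext (ModuleCat.of R (R ⧸ maximalIdeal R)) (ModuleCat.of R R) (d + n + 1)) :
        z = 0 := by
      obtain ⟨y, rfl⟩ := Ext.contravariant_sequence_exact₁ hS _ z (add_comm 1 _)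
        (Ext.eq_zero_of_hasInjectiveDimensionLT _ (d + (n + 1) + 1) (by lia))
      rw [y.eq_zero_of_hasProjectiveDimensionLT (d + 1) (by lia), Ext.comp_zero]
    exact ⟨fun x y => by rw [h₀ x, h₀ y]⟩

/-- A Gorenstein ring of finite Krull dimension has finite injective dimension over itself. -/
lemma exists_hasInjectiveDimensionLE (hR : IsGorensteinRing R) (hd : ringKrullDim R ≠ ⊤) :
    ∃ N : ℕ, HasInjectiveDimensionLE (ModuleCat.of R R) N := by
  have := hR.1
  obtain ⟨N, hN⟩ : ∃ N : ℕ, ringKrullDim R ≤ N := by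
    by_contra! h
    exact hd (ENat.WithBot.eq_top_iff_forall_ge.2 fun m => (h m).le)
  refine ⟨N, ?_⟩
  rw [ModuleCat.hasInjectiveDimensionLE_iff_forall_primeSpectrum]
  intro p
  obtain ⟨d, hd⟩ := hR.2 p.1
  have : HasInjectiveDimensionLE (ModuleCat.of (Localization.AtPrime p.1)
    (Localization.AtPrime p.1)) N := by
    refine hasInjectiveDimensionLE_self_of_isLocalRing N d ?_ ?_
    · rw [IsLocalization.AtPrime.ringKrullDim_eq_height p.1 (Localization.AtPrime p.1)]
      exact Ideal.height_le_ringKrullDim_of_isPrime.trans hN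
    · exact hasInjectiveDimensionLT_of_ge _ (d + 1) _ (by lia)
  have h' := ModuleCat.localizedModule_isLocalizedModule (ModuleCat.of R R) p.1.primeCompl
  refine (ModuleCat.hasInjectiveDimensionLE_iff_of_linearEquiv ?_ N).1 this
  exact (LinearEquiv.extendScalarsOfIsLocalization p.1.primeCompl (Localization.AtPrime p.1)
    (IsLocalizedModule.linearEquiv p.1.primeCompl
      (Algebra.linearMap R (Localization.AtPrime p.1))
      ((ModuleCat.of R R).localizedModuleMkLinearMap p.1.primeCompl)))

end Bass

/-! ### Sheaves on a finite poset: extension by zero, stalks, injective sheaves -/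

section Sheaves

variable {k : Type u} [CommRing k] {X : Type} [PartialOrder X]

/-- The stalks of the extension by zero of a sheaf on `U_p`: the stalk at `s` consists of the
families of elements of `A_s`, indexed by the proofs of `s ∈ U_p`. -/
abbrev ExtZero {p : X} (A : Shv k (Set.Ici p)) (s : X) : Type u :=
  (h : PLift (p ≤ s)) → A.obj ⟨s, h.down⟩

open Classical in
/-- The restriction maps of the extension by zero. -/
def extZeroRes {p : X} (A : Shv k (Set.Ici p)) {s t : X} (hst : s ≤ t) :
    ExtZero A s →ₗ[k] ExtZero A t :=
  LinearMap.pi fun ht => if hs : p ≤ s then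
    (A.map (X := ⟨s, hs⟩) (Y := ⟨t, ht.down⟩) (homOfLE hst)).hom ∘ₗ LinearMap.proj ⟨hs⟩ else 0

lemma extZeroRes_apply {p : X} (A : Shv k (Set.Ici p)) {s t : X} (hst : s ≤ t) (hs : p ≤ s)
    (ht : PLift (p ≤ t)) (x : ExtZero A s) :
    extZeroRes A hst x ht =
      (A.map (X := ⟨s, hs⟩) (Y := ⟨t, ht.down⟩) (homOfLE hst)).hom (x ⟨hs⟩) := by
  simp [extZeroRes, hs]

lemma extZeroRes_apply_of_not {p : X} (A : Shv k (Set.Ici p)) {s t : X} (hst : s ≤ t)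
    (hs : ¬ p ≤ s) (ht : PLift (p ≤ t)) (x : ExtZero A s) : extZeroRes A hst x ht = 0 := by
  simp [extZeroRes, hs]

/-- The extension by zero of a sheaf on the open subset `U_p`. -/
def extZero {p : X} (A : Shv k (Set.Ici p)) : Shv k X where
  obj s := ModuleCat.of k (ExtZero A s)
  map f := ModuleCat.ofHom (extZeroRes A f.le)
  map_id s := by
    refine ModuleCat.hom_ext (LinearMap.ext fun (x : ExtZero A s) => funext fun h => ?_)
    exact (extZeroRes_apply A le_rfl h.down h x).trans
      (congrArg (fun f => f.hom (x h)) (A.map_id ⟨s, h.down⟩))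
  map_comp {s t r} f g := by
    refine ModuleCat.hom_ext (LinearMap.ext fun (x : ExtZero A s) => funext fun h => ?_)
    change extZeroRes A (f ≫ g).le x h = extZeroRes A g.le (extZeroRes A f.le x) h
    by_cases hs : p ≤ s
    · rw [extZeroRes_apply A _ hs, extZeroRes_apply A _ (hs.trans f.le), extZeroRes_apply A _ hs]
      exact congrArg (fun f => f.hom (x ⟨hs⟩)) (A.map_comp (X := ⟨s, hs⟩) (Y := ⟨t, hs.trans f.le⟩)
        (Z := ⟨r, h.down⟩) f g)
    · rw [extZeroRes_apply_of_not A _ hs]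
      by_cases ht : p ≤ t
      · rw [extZeroRes_apply A _ ht, extZeroRes_apply_of_not A _ hs, map_zero]
      · rw [extZeroRes_apply_of_not A _ ht]

/-- The extension by zero of a morphism. -/
def extZeroMap {p : X} {A B : Shv k (Set.Ici p)} (f : A ⟶ B) : extZero A ⟶ extZero B where
  app s := ModuleCat.ofHom (X := ExtZero A s) (Y := ExtZero B s)
    (LinearMap.pi fun h => (f.app ⟨s, h.down⟩).hom ∘ₗ LinearMap.proj h)
  naturality s t g := by
    refine ModuleCat.hom_ext (LinearMap.ext fun (x : ExtZero A s) => funext fun h => ?_)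
    change (f.app ⟨t, h.down⟩).hom (extZeroRes A g.le x h) =
      extZeroRes B g.le (fun h => (f.app ⟨s, h.down⟩).hom (x h)) h
    by_cases hs : p ≤ s
    · rw [extZeroRes_apply _ _ hs, extZeroRes_apply _ _ hs]
      exact congrArg (fun l => l.hom (x ⟨hs⟩)) (f.naturality (X := ⟨s, hs⟩) (Y := ⟨t, h.down⟩)
        (homOfLE g.le))
    · rw [extZeroRes_apply_of_not _ _ hs, extZeroRes_apply_of_not _ _ hs, map_zero]

/-- The restriction of sheaves to the open subset `U_p`. -/
abbrev restrictSheaf (p : X) : Shv k X ⥤ Shv k (Set.Ici p) :=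
  (Functor.whiskeringLeft (Set.Ici p) X (ModuleCat.{u} k)).obj
    (Monotone.functor (Subtype.mono_coe _))

open Classical in
/-- The morphism out of the extension by zero of `A` given by a morphism `A ⟶ F|U_p`. -/
def extZeroDesc {p : X} {A : Shv k (Set.Ici p)} {F : Shv k X} (f : A ⟶ (restrictSheaf p).obj F) :
    extZero A ⟶ F where
  app s := ModuleCat.ofHom (X := ExtZero A s) (Y := F.obj s)
    (if h : p ≤ s then (f.app ⟨s, h⟩).hom ∘ₗ LinearMap.proj ⟨h⟩ else 0)
  naturality s t g := by
    refine ModuleCat.hom_ext (LinearMap.ext fun (x : ExtZero A s) => ?_)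
    by_cases hs : p ≤ s
    · have ht : p ≤ t := hs.trans g.le
      simp only [hs, ht, dite_true]
      change (f.app ⟨t, ht⟩).hom (extZeroRes A g.le x ⟨ht⟩) =
        (F.map g).hom ((f.app ⟨s, hs⟩).hom (x ⟨hs⟩))
      rw [extZeroRes_apply _ _ hs]
      exact congrArg (fun l => l.hom (x ⟨hs⟩)) (f.naturality (X := ⟨s, hs⟩) (Y := ⟨t, ht⟩)
        (homOfLE g.le))
    · by_cases ht : p ≤ t
      · simp only [hs, ht, dite_true, dite_false]
        change (f.app ⟨t, ht⟩).hom (extZeroRes A g.le x ⟨ht⟩) = (F.map g).hom 0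
        rw [extZeroRes_apply_of_not _ _ hs, map_zero, map_zero]
        rfl
      · simp only [hs, ht, dite_false]
        exact (map_zero (F.map g).hom).symm

lemma extZeroDesc_app_apply {p : X} {A : Shv k (Set.Ici p)} {F : Shv k X}
    (f : A ⟶ (restrictSheaf p).obj F) {s : X} (hs : p ≤ s) (x : ExtZero A s) :
    ((extZeroDesc f).app s).hom x = (f.app ⟨s, hs⟩).hom (x ⟨hs⟩) := by
  simp only [extZeroDesc, hs, dite_true]
  rfl

/-- The restriction of an injective sheaf to an open subset is injective, as restriction has
an exact left adjoint, the extension by zero. -/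
lemma injective_restrictSheaf (p : X) (F : Shv k X) [Injective F] :
    Injective ((restrictSheaf p).obj F) where
  factors {A B} g f _ := by
    have (s : X) : Mono ((extZeroMap f).app s) := by
      rw [ModuleCat.mono_iff_injective]
      intro (x : ExtZero A s) (y : ExtZero A s) hxy
      funext h
      have : Mono (f.app ⟨s, h.down⟩) := inferInstance
      exact (ModuleCat.mono_iff_injective _).1 this (congrFun hxy h)
    have : Mono (extZeroMap f) := NatTrans.mono_of_mono_app _
    obtain ⟨l, hl⟩ := Injective.factors (extZeroDesc g) (extZeroMap f)
    let ι (s : Set.Ici p) : B.obj s →ₗ[k] ExtZero B s.1 := LinearMap.pi fun _ => LinearMap.id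
    refine ⟨{ app := fun s => ModuleCat.ofHom ((l.app s.1).hom ∘ₗ ι s), naturality := ?_ }, ?_⟩
    · intro s t i
      refine ModuleCat.hom_ext (LinearMap.ext fun x => ?_)
      refine Eq.trans ?_ (congrArg (fun f => f.hom (ι s x)) (l.naturality (X := s.1) (Y := t.1)
        (homOfLE i.le)))
      refine congrArg (l.app t.1).hom (funext fun h => ?_)
      exact (extZeroRes_apply B i.le s.2 h (ι s x)).symm
    · ext s x
      have h := congrArg (fun f => (f.app s.1).hom (fun _ => x)) hl
      exact h.trans (extZeroDesc_app_apply g s.2 fun _ => x)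

end Sheaves

/-! ### Free sheaves -/

section Free

variable {k : Type u} [CommRing k] {X : Type} [PartialOrder X]

/-- The stalk at `s` of the sheaf which is constant with value `E` on `U_q` and zero outside
of `U_q`, as a submodule of `E`. -/
def freeStalk (q : X) (E : Type u) [AddCommGroup E] [Module k E] (s : X) : Submodule k E where
  carrier := {x | ¬ q ≤ s → x = 0}
  add_mem' hx hy h := by rw [hx h, hy h, add_zero]
  zero_mem' _ := rfl
  smul_mem' c x hx h := by rw [hx h, smul_zero]

lemma freeStalk_mono (q : X) (E : Type u) [AddCommGroup E] [Module k E] {s t : X} (h : s ≤ t) :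
    freeStalk (k := k) q E s ≤ freeStalk q E t :=
  fun _ hx ht => hx fun hs => ht (hs.trans h)

/-- The sheaf which is constant with value `E` on `U_q` and zero outside of `U_q`; it represents
the homomorphisms from `E` to the stalk at `q`. -/
def freeSheaf (q : X) : ModuleCat.{u} k ⥤ Shv k X where
  obj E :=
    { obj s := ModuleCat.of k (freeStalk (k := k) q E s)
      map f := ModuleCat.ofHom (Submodule.inclusion (freeStalk_mono q E f.le))
      map_id _ := rfl
      map_comp _ _ := rfl }
  map {E E'} f :=
    { app s := ModuleCat.ofHom (f.hom.restrict fun x (hx : ¬ q ≤ s → x = 0) h => by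
        rw [hx h, map_zero])
      naturality _ _ _ := rfl }
  map_id _ := rfl
  map_comp _ _ := rfl

instance (q : X) : (freeSheaf (k := k) q).Additive where
  map_add := rfl

open Classical in
/-- The morphism from a free sheaf to `F` given by a homomorphism to the stalk `F_q`. -/
def freeDesc {q : X} {E : ModuleCat.{u} k} {F : Shv k X} (e : E ⟶ F.obj q) :
    (freeSheaf q).obj E ⟶ F where
  app s := ModuleCat.ofHom (X := freeStalk (k := k) q E s) (Y := F.obj s)
    (if h : q ≤ s then res F h ∘ₗ e.hom ∘ₗ Submodule.subtype _ else 0)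
  naturality s t g := by
    refine ModuleCat.hom_ext (LinearMap.ext fun (x : freeStalk (k := k) q E s) => ?_)
    by_cases hs : q ≤ s
    · simp only [hs, hs.trans g.le, dite_true]
      exact (res_res F hs g.le (e.hom x.1)).symm
    · obtain rfl : x = 0 := Subtype.ext (x.2 hs)
      exact (map_zero _).trans (map_zero _).symm

lemma freeDesc_app_apply {q : X} {E : ModuleCat.{u} k} {F : Shv k X} (e : E ⟶ F.obj q) {s : X}
    (hs : q ≤ s) (x : freeStalk (k := k) q E s) :
    ((freeDesc e).app s).hom x = res F hs (e.hom x.1) := by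
  simp only [freeDesc, hs, dite_true]
  rfl

/-- The stalks of an injective sheaf are injective. -/
lemma injective_obj (F : Shv k X) [Injective F] (q : X) : Injective (F.obj q) where
  factors {A B} g f _ := by
    have (s : X) : Mono (((freeSheaf q).map f).app s) := by
      rw [ModuleCat.mono_iff_injective]
      intro (x : freeStalk (k := k) q A s) (y : freeStalk (k := k) q A s) hxy
      exact Subtype.ext ((ModuleCat.mono_iff_injective f).1 inferInstance
        (congrArg Subtype.val hxy))
    have : Mono ((freeSheaf q).map f) := NatTrans.mono_of_mono_app _
    obtain ⟨l, hl⟩ := Injective.factors (freeDesc g) ((freeSheaf q).map f)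
    let ι (E : ModuleCat.{u} k) : E →ₗ[k] freeStalk (k := k) q E q :=
      LinearMap.codRestrict _ LinearMap.id fun _ h => (h le_rfl).elim
    refine ⟨ModuleCat.ofHom ((l.app q).hom ∘ₗ ι B), ModuleCat.hom_ext (LinearMap.ext fun x => ?_)⟩
    refine (congrArg (fun h => (h.app q).hom (ι A x)) hl).trans ?_
    exact (freeDesc_app_apply g le_rfl (ι A x)).trans (res_refl F q _)

/-- The homomorphism `F_p ⟶ F_q` for `p ≤ q`, for a complex of sheaves. -/
def stalkRes (F : CochainComplex (Shv k X) ℤ) {p q : X} (h : p ≤ q) : stalk p F ⟶ stalk q F where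
  f i := (F.X i).map (homOfLE h)
  comm' i j _ := (F.d i j).naturality (homOfLE h)

/-- The stalk at `p` of a morphism of complexes of sheaves. -/
abbrev stalkHom (p : X) {F G : CochainComplex (Shv k X) ℤ} (f : F ⟶ G) : stalk p F ⟶ stalk p G :=
  (((evaluation X (ModuleCat.{u} k)).obj p).mapHomologicalComplex _).map f

lemma stalkRes_naturality {F G : CochainComplex (Shv k X) ℤ} (f : F ⟶ G) {p q : X} (h : p ≤ q) :
    stalkRes F h ≫ stalkHom q f = stalkHom p f ≫ stalkRes G h := by
  ext i : 1
  exact (f.f i).naturality (homOfLE h)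

lemma quasiIso_iff_stalkHom {F G : CochainComplex (Shv k X) ℤ} (f : F ⟶ G) :
    QuasiIso f ↔ ∀ p, QuasiIso (stalkHom p f) :=
  HomologicalComplex.quasiIso_iff_evaluation f

/-- The complexes of sheaves which are constant on `U_q` and zero outside of `U_q`. -/
structure IsFree (q : X) (G : CochainComplex (Shv k X) ℤ) : Prop where
  isZero (i : ℤ) (s : X) (h : ¬ q ≤ s) : IsZero ((G.X i).obj s)
  isIso (i : ℤ) {r s : X} (h : q ≤ r) (h' : r ≤ s) : IsIso ((G.X i).map (homOfLE h'))

lemma IsFree.shift {q : X} {G : CochainComplex (Shv k X) ℤ} (hG : IsFree q G) (n : ℤ) :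
    IsFree q (G⟦n⟧) where
  isZero i s h := hG.isZero (i + n) s h
  isIso i _ _ h h' := hG.isIso (i + n) h h'

lemma IsFree.isIso_stalkRes {q : X} {G : CochainComplex (Shv k X) ℤ} (hG : IsFree q G) {r s : X}
    (h : q ≤ r) (h' : r ≤ s) : IsIso (stalkRes G h') := by
  have (i : ℤ) : IsIso ((stalkRes G h').f i) := hG.isIso i h h'
  exact HomologicalComplex.Hom.isIso_of_components _

lemma IsFree.acyclic_stalk {q : X} {G : CochainComplex (Shv k X) ℤ} (hG : IsFree q G) {s : X}
    (h : ¬ q ≤ s) : (stalk s G).Acyclic := fun i =>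
  (HomologicalComplex.exactAt_iff _ _).2 (ShortComplex.exact_of_isZero_X₂ _ (hG.isZero i s h))

/-- The complex of free sheaves given by a complex of modules. -/
abbrev freeCx (q : X) (E : CochainComplex (ModuleCat.{u} k) ℤ) : CochainComplex (Shv k X) ℤ :=
  ((freeSheaf q).mapHomologicalComplex _).obj E

lemma isFree_freeCx (q : X) (E : CochainComplex (ModuleCat.{u} k) ℤ) : IsFree q (freeCx q E) where
  isZero i s h := ModuleCat.isZero_iff_subsingleton.2
    ⟨fun (x : freeStalk (k := k) q (E.X i) s) (y : freeStalk (k := k) q (E.X i) s) =>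
      Subtype.ext ((x.2 h).trans (y.2 h).symm)⟩
  isIso i r s h h' := by
    rw [ConcreteCategory.isIso_iff_bijective]
    exact ⟨Submodule.inclusion_injective (freeStalk_mono q (E.X i) h'),
      fun (x : freeStalk (k := k) q (E.X i) s) => ⟨⟨x.1, fun hr => (hr h).elim⟩, rfl⟩⟩

/-- The canonical morphism from the complex of free sheaves given by the stalk `F_q` to `F`. -/
def freeCounit (q : X) (F : CochainComplex (Shv k X) ℤ) : freeCx q (stalk q F) ⟶ F where
  f i := freeDesc (𝟙 ((F.X i).obj q))
  comm' i j _ := by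
    ext s (x : freeStalk (k := k) q ((F.X i).obj q) s)
    by_cases hs : q ≤ s
    · refine (congrArg ((F.d i j).app s).hom (freeDesc_app_apply (𝟙 _) hs x)).trans ?_
      exact (res_hom (F.d i j) hs x.1).symm.trans (freeDesc_app_apply (𝟙 ((F.X j).obj q)) hs
        ((((freeSheaf q).map ((F.d i j).app q)).app s).hom x)).symm
    · obtain rfl : x = 0 := Subtype.ext (x.2 hs)
      exact (map_zero _).trans (map_zero _).symm

lemma isIso_stalkHom_freeCounit (q : X) (F : CochainComplex (Shv k X) ℤ) :
    IsIso (stalkHom q (freeCounit q F)) := by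
  have (i : ℤ) : IsIso ((stalkHom q (freeCounit q F)).f i) := by
    rw [ConcreteCategory.isIso_iff_bijective]
    have h (x : freeStalk (k := k) q ((F.X i).obj q) q) :
        ((stalkHom q (freeCounit q F)).f i).hom x = x.1 :=
      (freeDesc_app_apply (𝟙 ((F.X i).obj q)) le_rfl x).trans (res_refl _ _ _)
    exact ⟨fun x y hxy => Subtype.ext ((h x).symm.trans (hxy.trans (h y))),
      fun y => ⟨⟨y, fun hq => (hq le_rfl).elim⟩, h _⟩⟩
  exact HomologicalComplex.Hom.isIso_of_components _

end Free

/-! ### Exactness of duality for complexes of sheaves -/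

section Duality

variable {k : Type u} [CommRing k] {X : Type} [PartialOrder X]

/-- The functor of stalks at `p`. -/
abbrev stalkFunctor (p : X) :
    CochainComplex (Shv k X) ℤ ⥤ CochainComplex (ModuleCat.{u} k) ℤ :=
  ((evaluation X (ModuleCat.{u} k)).obj p).mapHomologicalComplex _

/-- The restriction of complexes of sheaves to the open subset `U_p`. -/
abbrev restrictFunctor (p : X) :
    CochainComplex (Shv k X) ℤ ⥤ CochainComplex (Shv k (Set.Ici p)) ℤ :=
  (restrictSheaf p).mapHomologicalComplex _

lemma shortExact_map_mapHomologicalComplex {C D : Type*} [Category* C] [Category* D] [Abelian C]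
    [Abelian D] (Φ : C ⥤ D) [Φ.Additive] [PreservesFiniteLimits Φ] [PreservesFiniteColimits Φ]
    {S : ShortComplex (CochainComplex C ℤ)} (hS : S.ShortExact) :
    (S.map (Φ.mapHomologicalComplex _)).ShortExact :=
  HomologicalComplex.shortExact_of_degreewise_shortExact _ fun i =>
    (hS.map_of_exact (HomologicalComplex.eval C _ i)).map_of_exact Φ

lemma exact_of_evaluation {S : ShortComplex (Shv k X)}
    (h : ∀ p, (S.map ((evaluation X (ModuleCat.{u} k)).obj p)).Exact) : S.Exact := by
  rw [ShortComplex.exact_iff_isZero_homology, Functor.isZero_iff]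
  exact fun p => ((ShortComplex.exact_iff_isZero_homology _).1 (h p)).of_iso
    (S.mapHomologyIso ((evaluation X (ModuleCat.{u} k)).obj p)).symm

lemma shortExact_of_evaluation {S : ShortComplex (Shv k X)}
    (h : ∀ p, (S.map ((evaluation X (ModuleCat.{u} k)).obj p)).ShortExact) : S.ShortExact where
  exact := exact_of_evaluation fun p => (h p).exact
  mono_f := by
    have (p : X) : Mono (S.f.app p) := (h p).mono_f
    exact NatTrans.mono_of_mono_app _
  epi_g := by
    have (p : X) : Epi (S.g.app p) := (h p).epi_g
    exact NatTrans.epi_of_epi_app _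

lemma shortExact_of_stalk {S : ShortComplex (CochainComplex (Shv k X) ℤ)}
    (h : ∀ p, (S.map (stalkFunctor p)).ShortExact) : S.ShortExact :=
  HomologicalComplex.shortExact_of_degreewise_shortExact _ fun i =>
    shortExact_of_evaluation fun p => (h p).map_of_exact (HomologicalComplex.eval _ _ i)

/-- The morphism `ℋom^•(F', G) ⟶ ℋom^•(F, G)` given by a morphism `F ⟶ F'`. -/
def sheafHomPre {F F' : CochainComplex (Shv k X) ℤ} (f : F ⟶ F') (G : CochainComplex (Shv k X) ℤ) :
    sheafHom F' G ⟶ sheafHom F G where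
  f m :=
    { app p := (homCxPre k ((restrictFunctor p).map f) (restrictU p G)).f m
      naturality p q h := by
        refine ModuleCat.hom_ext (LinearMap.ext
          fun (φ : Cochain (restrictU p F') (restrictU p G) m) => ?_)
        change (Cochain.ofHom ((restrictFunctor q).map f)).comp (restrictCochain F' G h.le m φ)
            (zero_add m) =
          restrictCochain F G h.le m
            ((Cochain.ofHom ((restrictFunctor p).map f)).comp φ (zero_add m))
        ext a b hab s : 3
        rw [Cochain.zero_cochain_comp_v, Cochain.ofHom_v, restrictCochain_v, restrictCochain_v,
          Cochain.zero_cochain_comp_v, Cochain.ofHom_v]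
        rfl }
  comm' i j _ := by
    ext p : 2
    exact (homCxPre k ((restrictFunctor p).map f) (restrictU p G)).comm i j

lemma sheafHomPre_comp_eq_zero (S : ShortComplex (CochainComplex (Shv k X) ℤ))
    (G : CochainComplex (Shv k X) ℤ) : sheafHomPre S.g G ≫ sheafHomPre S.f G = 0 := by
  refine HomologicalComplex.hom_ext _ _ fun i => NatTrans.ext (funext fun p => ?_)
  have h : homCxPre k ((restrictFunctor p).map S.g) (restrictU p G) ≫
      homCxPre k ((restrictFunctor p).map S.f) (restrictU p G) = 0 := by
    rw [← homCxPre_comp, ← Functor.map_comp, S.zero, Functor.map_zero, homCxPre_zero]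
  exact congrArg (fun f => f.f i) h

/-- The short complex of sheaf complexes obtained by duality. -/
abbrev sheafHomShortComplex (S : ShortComplex (CochainComplex (Shv k X) ℤ))
    (G : CochainComplex (Shv k X) ℤ) : ShortComplex (CochainComplex (Shv k X) ℤ) :=
  ShortComplex.mk _ _ (sheafHomPre_comp_eq_zero S G)

lemma sheafHom_shortExact {S : ShortComplex (CochainComplex (Shv k X) ℤ)} (hS : S.ShortExact)
    (G : CochainComplex (Shv k X) ℤ) (hG : ∀ i, Injective (G.X i)) :
    (sheafHomShortComplex S G).ShortExact :=
  shortExact_of_stalk fun p =>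
    homCx_shortExact (shortExact_map_mapHomologicalComplex (restrictSheaf p) hS) (restrictU p G)
      fun i => injective_restrictSheaf p (G.X i)

lemma stalkMap_ofHom_comp {F F' G : CochainComplex (Shv k X) ℤ} (f : F ⟶ F') {p : X} {a : ℤ}
    (φ : Cochain (restrictU p F') (restrictU p G) a) (m b : ℤ) (hab : m + a = b) (q : X)
    (hq : p ≤ q) (x : (F.X m).obj q) :
    stalkMap ((Cochain.ofHom ((restrictFunctor p).map f)).comp φ (zero_add a)) m b hab q hq x =
      stalkMap φ m b hab q hq (((f.f m).app q).hom x) := by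
  simp only [stalkMap]
  rw [Cochain.zero_cochain_comp_v, Cochain.ofHom_v]
  rfl

lemma biduality_naturality {F F' : CochainComplex (Shv k X) ℤ} (f : F ⟶ F')
    (G : CochainComplex (Shv k X) ℤ) :
    biduality F G ≫ sheafHomPre (sheafHomPre f G) G = f ≫ biduality F' G := by
  refine HomologicalComplex.hom_ext _ _ fun m => NatTrans.ext (funext fun p =>
    ModuleCat.hom_ext (LinearMap.ext fun x => ?_))
  change (Cochain.ofHom ((restrictFunctor p).map (sheafHomPre f G))).comp (evalCochain F G m p x)
    (zero_add m) = evalCochain F' G m p (((f.f m).app p).hom x)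
  ext a b hab q : 3
  refine ModuleCat.hom_ext (LinearMap.ext fun (φ : Cochain (restrictU q.1 F') (restrictU q.1 G) a)
    => ?_)
  rw [Cochain.zero_cochain_comp_v, Cochain.ofHom_v]
  refine (evalAt_apply F G m a b hab q.2 x _).trans (Eq.trans ?_
    (evalAt_apply F' G m a b hab q.2 (((f.f m).app p).hom x) φ).symm)
  refine congrArg (fun y => (m * a).negOnePow • y) ?_
  exact (stalkMap_ofHom_comp f φ m b (by lia) q.1 le_rfl _).trans
    (congrArg _ (res_hom (f.f m) q.2 x).symm)

/-- The biduality morphism of a short complex of complexes of sheaves. -/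
def bidualityShortComplex (S : ShortComplex (CochainComplex (Shv k X) ℤ))
    (G : CochainComplex (Shv k X) ℤ) :
    S ⟶ sheafHomShortComplex (sheafHomShortComplex S G) G where
  τ₁ := biduality S.X₁ G
  τ₂ := biduality S.X₂ G
  τ₃ := biduality S.X₃ G
  comm₁₂ := biduality_naturality S.f G
  comm₂₃ := biduality_naturality S.g G

/-! ### Evaluation of sheaf homomorphisms on a stalk -/

/-- The cochain of homomorphisms between the stalks at `r` induced by a cochain of homomorphisms
of sheaves on `U_p`, for `p ≤ r`. -/
def stalkCochain {F G : CochainComplex (Shv k X) ℤ} {p r : X} (h : p ≤ r) {m : ℤ}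
    (φ : Cochain (restrictU p F) (restrictU p G) m) : Cochain (stalk r F) (stalk r G) m :=
  Cochain.mk fun a b hab => ModuleCat.ofHom (stalkMap φ a b hab r h)

lemma stalkCochain_v {F G : CochainComplex (Shv k X) ℤ} {p r : X} (h : p ≤ r) {m : ℤ}
    (φ : Cochain (restrictU p F) (restrictU p G) m) (a b : ℤ) (hab : a + m = b) :
    (stalkCochain h φ).v a b hab = ModuleCat.ofHom (stalkMap φ a b hab r h) := rfl

/-- The homomorphism `ℋom^•(F, G)_p ⟶ Hom^•(F_r, G_r)` for `p ≤ r`. -/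
def evalStalk (F G : CochainComplex (Shv k X) ℤ) {p r : X} (h : p ≤ r) :
    stalk p (sheafHom F G) ⟶ homCx k (stalk r F) (stalk r G) where
  f m := ModuleCat.ofHom (X := Cochain (restrictU p F) (restrictU p G) m)
      (Y := Cochain (stalk r F) (stalk r G) m)
    { toFun := stalkCochain h
      map_add' := fun _ _ => rfl
      map_smul' := fun _ _ => rfl }
  comm' m m' hm := by
    refine ModuleCat.hom_ext (LinearMap.ext
      fun (φ : Cochain (restrictU p F) (restrictU p G) m) => ?_)
    change δ m m' (stalkCochain h φ) = stalkCochain h (δ m m' φ)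
    ext a b hab : 1
    rw [stalkCochain_v, δ_v m m' hm _ a b hab (b - 1) (a + 1) rfl rfl, stalkCochain_v,
      stalkCochain_v]
    exact ModuleCat.hom_ext (LinearMap.ext fun x => (stalkMap_δ hm φ a b hab r h x).symm)

lemma stalkRes_evalStalk (F G : CochainComplex (Shv k X) ℤ) {p q r : X} (h : p ≤ q) (h' : q ≤ r) :
    stalkRes (sheafHom F G) h ≫ evalStalk F G h' = evalStalk F G (h.trans h') := rfl

lemma evalStalk_naturality {F F' : CochainComplex (Shv k X) ℤ} (f : F ⟶ F')
    (G : CochainComplex (Shv k X) ℤ) {p r : X} (h : p ≤ r) :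
    stalkHom p (sheafHomPre f G) ≫ evalStalk F G h =
      evalStalk F' G h ≫ homCxPre k (stalkHom r f) (stalk r G) := by
  refine HomologicalComplex.hom_ext _ _ fun m => ModuleCat.hom_ext (LinearMap.ext
    fun (φ : Cochain (restrictU p F') (restrictU p G) m) => ?_)
  change stalkCochain h ((Cochain.ofHom ((restrictFunctor p).map f)).comp φ (zero_add m)) =
    (Cochain.ofHom (stalkHom r f)).comp (stalkCochain h φ) (zero_add m)
  ext a b hab : 1
  rw [stalkCochain_v, Cochain.zero_cochain_comp_v, Cochain.ofHom_v, stalkCochain_v]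
  exact ModuleCat.hom_ext (LinearMap.ext fun x => stalkMap_ofHom_comp f φ a b hab r h x)

/-- Evaluation on stalks turns the biduality of sheaves into that of modules. -/
lemma biduality_evalStalk (F G : CochainComplex (Shv k X) ℤ) {p r : X} (h : p ≤ r) :
    stalkHom p (biduality F G) ≫ evalStalk (sheafHom F G) G h =
      stalkRes F h ≫ ev (stalk r F) (stalk r G) ≫
        homCxPre k (evalStalk F G (le_refl r)) (stalk r G) := by
  refine HomologicalComplex.hom_ext _ _ fun m => ModuleCat.hom_ext (LinearMap.ext fun x => ?_)
  change stalkCochain h (evalCochain F G m p x) =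
    (Cochain.ofHom (evalStalk F G (le_refl r))).comp
      (evCochain (stalk r F) (stalk r G) m (res (F.X m) h x)) (zero_add m)
  ext a b hab : 1
  rw [stalkCochain_v, Cochain.zero_cochain_comp_v, Cochain.ofHom_v]
  rfl

end Duality

/-! ### Duality for free sheaves -/

section FreeHom

variable {k : Type u} [CommRing k] {Y : Type} [PartialOrder Y] {A B : Shv k Y} {r : Y}

/-- The first two hypotheses say that `A` is zero outside of `U_r` and constant on `U_r`; then
morphisms out of `A` are determined by their values at `r`. -/
lemma hom_ext_of_free (h₀ : ∀ s, ¬ r ≤ s → IsZero (A.obj s))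
    (h₁ : ∀ (s : Y) (h : r ≤ s), IsIso (A.map (homOfLE h))) {f g : A ⟶ B}
    (h : f.app r = g.app r) : f = g := by
  ext s : 2
  by_cases hs : r ≤ s
  · have := h₁ s hs
    rw [← cancel_epi (A.map (homOfLE hs)), f.naturality, g.naturality, h]
  · exact (h₀ s hs).eq_of_src _ _

open Classical in
lemma exists_hom_of_free (h₀ : ∀ s, ¬ r ≤ s → IsZero (A.obj s))
    (h₁ : ∀ (s : Y) (h : r ≤ s), IsIso (A.map (homOfLE h))) (e : A.obj r ⟶ B.obj r) :
    ∃ f : A ⟶ B, f.app r = e := by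
  refine ⟨{ app := fun s => if h : r ≤ s then
    (@asIso _ _ _ _ _ (h₁ s h)).inv ≫ e ≫ B.map (homOfLE h) else 0, naturality := ?_ }, ?_⟩
  · intro s t g
    by_cases hs : r ≤ s
    · have ht : r ≤ t := hs.trans g.le
      have := h₁ s hs
      have := h₁ t ht
      rw [dif_pos hs, dif_pos ht]
      rw [← cancel_epi (A.map (homOfLE hs)), ← Category.assoc, ← A.map_comp]
      change A.map (homOfLE ht) ≫ inv (A.map (homOfLE ht)) ≫ _ =
        A.map (homOfLE hs) ≫ (inv (A.map (homOfLE hs)) ≫ e ≫ B.map (homOfLE hs)) ≫ B.map g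
      rw [IsIso.hom_inv_id_assoc, Category.assoc, Category.assoc, IsIso.hom_inv_id_assoc,
        ← B.map_comp]
      rfl
    · exact (h₀ s hs).eq_of_src _ _
  · have := h₁ r le_rfl
    simp only [le_refl, dite_true]
    change inv (A.map (𝟙 r)) ≫ e ≫ B.map (𝟙 r) = e
    simp

end FreeHom

section Evaluation

variable {k : Type u} [CommRing k] {X : Type} [PartialOrder X]

/-- If `F` is free on `U_q`, then sections over `U_p` of `ℋom^•(F, G)` are determined by their
values at the least element `r` of `U_p ∩ U_q`. -/
lemma quasiIso_evalStalk_of_isFree {p q r : X} (hp : p ≤ r) (hq : q ≤ r)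
    (hr : ∀ s, p ≤ s → q ≤ s → r ≤ s) {F : CochainComplex (Shv k X) ℤ} (hF : IsFree q F)
    (G : CochainComplex (Shv k X) ℤ) : QuasiIso (evalStalk F G hp) := by
  have h₀ (i : ℤ) (s : Set.Ici p) (hs : ¬ (⟨r, hp⟩ : Set.Ici p) ≤ s) :
      IsZero (((restrictU p F).X i).obj s) :=
    hF.isZero i s.1 fun h => hs (hr s.1 s.2 h)
  have h₁ (i : ℤ) (s : Set.Ici p) (hs : (⟨r, hp⟩ : Set.Ici p) ≤ s) :
      IsIso (((restrictU p F).X i).map (homOfLE hs)) := hF.isIso i hq hs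
  refine quasiIso_of_bijective _ fun m => ⟨?_, ?_⟩
  · intro (φ : Cochain (restrictU p F) (restrictU p G) m)
      (ψ : Cochain (restrictU p F) (restrictU p G) m) (h : stalkCochain hp φ = stalkCochain hp ψ)
    change φ = ψ
    ext a b hab : 1
    exact hom_ext_of_free (h₀ a) (h₁ a) (Cochain.congr_v h a b hab)
  · intro (ψ : Cochain (stalk r F) (stalk r G) m)
    choose f hf using fun a b hab =>
      exists_hom_of_free (B := (restrictU p G).X b) (h₀ a) (h₁ a) (ψ.v a b hab)
    refine ⟨(Cochain.mk f : Cochain (restrictU p F) (restrictU p G) m), ?_⟩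
    change stalkCochain hp (Cochain.mk f) = ψ
    ext a b hab : 1
    exact hf a b hab

lemma acyclic_mapHomologicalComplex {C D : Type*} [Category* C] [Category* D] [Abelian C]
    [Abelian D] (Φ : C ⥤ D) [Φ.Additive] [PreservesFiniteLimits Φ] [PreservesFiniteColimits Φ]
    {F : CochainComplex C ℤ} (hF : F.Acyclic) : ((Φ.mapHomologicalComplex _).obj F).Acyclic :=
  fun i => (HomologicalComplex.exactAt_iff _ _).2
    (((HomologicalComplex.exactAt_iff _ _).1 (hF i)).map Φ)

lemma acyclic_iff_stalk (F : CochainComplex (Shv k X) ℤ) :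
    F.Acyclic ↔ ∀ p, (stalk p F).Acyclic := by
  refine ⟨fun h p => acyclic_mapHomologicalComplex _ h, fun h i => ?_⟩
  rw [HomologicalComplex.exactAt_iff]
  exact exact_of_evaluation fun p => (HomologicalComplex.exactAt_iff _ _).1 (h p i)

lemma quasiIso_of_acyclic {C : Type*} [Category* C] [Abelian C] {K L : CochainComplex C ℤ}
    (f : K ⟶ L) (hK : K.Acyclic) (hL : L.Acyclic) : QuasiIso f := by
  rw [quasiIso_iff]
  intro i
  rw [quasiIsoAt_iff_exactAt _ _ (hK i)]
  exact hL i

end Evaluation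

section Dualizing

variable {k : Type u} [CommRing k] {n : ℕ}

/-- The properties of an injective resolution of the sheaf `ω` on which duality depends. -/
structure IsDualizing (L : CochainComplex (Shv k (Affine n)) ℤ) : Prop where
  isStrictlyGE : L.IsStrictlyGE 0
  injective (i : ℤ) : Injective (L.X i)
  acyclic (p : Affine n) (hp : p ≠ Finset.univ) : (stalk p L).Acyclic

variable {L : CochainComplex (Shv k (Affine n)) ℤ}

lemma IsDualizing.isKInjective_restrictU (hL : IsDualizing L) (p : Affine n) :
    (restrictU p L).IsKInjective := by
  have := hL.isStrictlyGE
  have (i : ℤ) : Injective ((restrictU p L).X i) :=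
    have := hL.injective i
    injective_restrictSheaf p (L.X i)
  exact CochainComplex.isKInjective_of_injective _ 0

lemma IsDualizing.isKInjective_stalk (hL : IsDualizing L) (p : Affine n) :
    (stalk p L).IsKInjective := by
  have := hL.isStrictlyGE
  have (i : ℤ) : Injective ((stalk p L).X i) :=
    have := hL.injective i
    injective_obj (L.X i) p
  exact CochainComplex.isKInjective_of_injective _ 0

lemma IsDualizing.quasiIso_sheafHomPre (hL : IsDualizing L)
    {F G : CochainComplex (Shv k (Affine n)) ℤ} (f : F ⟶ G) [QuasiIso f] :
    QuasiIso (sheafHomPre f L) := by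
  rw [quasiIso_iff_stalkHom]
  intro p
  have := hL.isKInjective_restrictU p
  have : QuasiIso ((restrictFunctor p).map f) := inferInstance
  exact quasiIso_homCxPre (k := k) ((restrictFunctor p).map f) (restrictU p L)

lemma IsDualizing.acyclic_stalk_sheafHom_of_acyclic (hL : IsDualizing L)
    {F : CochainComplex (Shv k (Affine n)) ℤ} (hF : F.Acyclic) (p : Affine n) :
    (stalk p (sheafHom F L)).Acyclic := by
  have := hL.isKInjective_restrictU p
  exact homCx_acyclic_of_left (k := k) (acyclic_mapHomologicalComplex (restrictSheaf p) hF)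
    (restrictU p L)

/-- The dual of a free sheaf on `U_q` vanishes at the points `p` such that `U_p ∩ U_q` does not
only consist of the open point. -/
lemma IsDualizing.acyclic_stalk_sheafHom (hL : IsDualizing L) {p q : Affine n}
    (hpq : p ∪ q ≠ Finset.univ) {F : CochainComplex (Shv k (Affine n)) ℤ} (hF : IsFree q F) :
    (stalk p (sheafHom F L)).Acyclic := by
  have hp : p ≤ p ∪ q := Finset.subset_union_left
  have := quasiIso_evalStalk_of_isFree hp Finset.subset_union_right
    (fun s => Finset.union_subset) hF L
  have := hL.isKInjective_stalk (p ∪ q)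
  have h := homCx_acyclic_of_right (k := k) (stalk (p ∪ q) F) (hL.acyclic _ hpq)
  intro i
  rw [exactAt_iff_of_quasiIsoAt (evalStalk F L hp)]
  exact h i

/-- The dual of a free sheaf on `U_q` at the points `p` such that `U_p ∩ U_q` only consists of the
open point. -/
lemma quasiIso_evalStalk_univ {p q : Affine n} (hpq : p ∪ q = Finset.univ)
    {F : CochainComplex (Shv k (Affine n)) ℤ} (hF : IsFree q F)
    (G : CochainComplex (Shv k (Affine n)) ℤ) :
    QuasiIso (evalStalk F G (Finset.subset_univ p)) :=
  quasiIso_evalStalk_of_isFree (Finset.subset_univ p) (Finset.subset_univ q)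
    (fun _ hp hq => hpq ▸ Finset.union_subset hp hq) hF G

lemma union_compl_eq_univ_iff (p q : Affine n) : p ∪ qᶜ = Finset.univ ↔ q ⊆ p := by
  simp only [Finset.ext_iff, Finset.mem_union, Finset.mem_compl, Finset.mem_univ, iff_true,
    Finset.subset_iff]
  exact forall_congr' fun _ => by tauto

lemma compl_subset_iff_union_eq_univ (p q : Affine n) : qᶜ ⊆ p ↔ p ∪ q = Finset.univ := by
  rw [← union_compl_eq_univ_iff, compl_compl]

/-- The dual of a free sheaf on `U_q` is quasi-isomorphic to a free sheaf on `U_r`, where `r` is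
the complement of `q`. -/
lemma IsDualizing.quasiIso_freeCounit (hL : IsDualizing L) {q : Affine n}
    {F : CochainComplex (Shv k (Affine n)) ℤ} (hF : IsFree q F) :
    QuasiIso (freeCounit qᶜ (sheafHom F L)) := by
  have hG := isFree_freeCx (k := k) qᶜ (stalk qᶜ (sheafHom F L))
  rw [quasiIso_iff_stalkHom]
  intro p
  by_cases hp : qᶜ ⊆ p
  · have := quasiIso_evalStalk_univ ((compl_subset_iff_union_eq_univ p q).1 hp) hF L
    have := quasiIso_evalStalk_univ
      ((compl_subset_iff_union_eq_univ qᶜ q).1 (Finset.Subset.refl _)) hF L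
    have : QuasiIso (stalkRes (sheafHom F L) hp ≫ evalStalk F L (Finset.subset_univ p)) := by
      rwa [stalkRes_evalStalk]
    have := quasiIso_of_comp_right (stalkRes (sheafHom F L) hp)
      (evalStalk F L (Finset.subset_univ p))
    have := isIso_stalkHom_freeCounit qᶜ (sheafHom F L)
    have := hG.isIso_stalkRes le_rfl hp
    have : QuasiIso (stalkRes (freeCx qᶜ (stalk qᶜ (sheafHom F L))) hp ≫
        stalkHom p (freeCounit qᶜ (sheafHom F L))) := by
      rw [stalkRes_naturality]
      infer_instance
    exact quasiIso_of_comp_left (stalkRes (freeCx qᶜ (stalk qᶜ (sheafHom F L))) hp) _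
  · exact quasiIso_of_acyclic _ (hG.acyclic_stalk hp)
      (hL.acyclic_stalk_sheafHom (fun h => hp ((compl_subset_iff_union_eq_univ p q).2 h)) hF)

/-- A complex of sheaves is reflexive if it is isomorphic to its bidual and the stalks of its dual
belong to the given class. -/
def IsReflexive (W : CochainComplex (ModuleCat.{u} k) ℤ → Prop)
    (L F : CochainComplex (Shv k (Affine n)) ℤ) : Prop :=
  (∀ p, W (stalk p (sheafHom F L))) ∧ QuasiIso (biduality F L)

variable {W : CochainComplex (ModuleCat.{u} k) ℤ → Prop} (hW : IsStableClass W)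

include hW in
/-- For a free sheaf on `U_q`, biduality is the biduality of its stalk at the open point. -/
lemma IsDualizing.isReflexive_of_isFree (hL : IsDualizing L) {q : Affine n}
    {F : CochainComplex (Shv k (Affine n)) ℤ} (hF : IsFree q F)
    (h : W (homCx k (stalk Finset.univ F) (stalk Finset.univ L)))
    (hev : QuasiIso (ev (stalk Finset.univ F) (stalk Finset.univ L))) : IsReflexive W L F := by
  have := hL.isKInjective_stalk (Finset.univ : Affine n)
  refine ⟨fun p => ?_, ?_⟩
  · by_cases hpq : p ∪ q = Finset.univ
    · exact (hW.iff_of_quasiIso _ (quasiIso_evalStalk_univ hpq hF L)).2 h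
    · exact hW.of_acyclic (hL.acyclic_stalk_sheafHom hpq hF)
  · have := hL.quasiIso_freeCounit hF
    have hG := isFree_freeCx (k := k) qᶜ (stalk qᶜ (sheafHom F L))
    have h₁ := (quasiIso_iff_stalkHom _).1 (hL.quasiIso_sheafHomPre (freeCounit qᶜ (sheafHom F L)))
    have h₂ := (quasiIso_iff_stalkHom (freeCounit qᶜ (sheafHom F L))).1 inferInstance Finset.univ
    rw [quasiIso_iff_stalkHom]
    intro p
    have := h₁ p
    by_cases hp : q ⊆ p
    · have h₃ := quasiIso_evalStalk_univ ((union_compl_eq_univ_iff p q).2 hp) hG L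
      have h₄ : QuasiIso (evalStalk (sheafHom F L) L (Finset.subset_univ p) ≫
          homCxPre k (stalkHom Finset.univ (freeCounit qᶜ (sheafHom F L)))
            (stalk Finset.univ L)) := by
        rw [← evalStalk_naturality]
        infer_instance
      have := quasiIso_of_comp_right (evalStalk (sheafHom F L) L (Finset.subset_univ p)) (homCxPre k
        (stalkHom Finset.univ (freeCounit qᶜ (sheafHom F L))) (stalk Finset.univ L))
      have := quasiIso_evalStalk_univ (p := Finset.univ) (q := q) (by simp) hF L
      have := hF.isIso_stalkRes hp (Finset.subset_univ p)
      have : QuasiIso (stalkHom p (biduality F L) ≫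
          evalStalk (sheafHom F L) L (Finset.subset_univ p)) := by
        rw [biduality_evalStalk]
        infer_instance
      exact quasiIso_of_comp_right _ (evalStalk (sheafHom F L) L (Finset.subset_univ p))
    · have h₃ := hL.acyclic_stalk_sheafHom (fun h => hp ((union_compl_eq_univ_iff p q).1 h)) hG
      refine quasiIso_of_acyclic _ (hF.acyclic_stalk hp) fun i => ?_
      rw [exactAt_iff_of_quasiIsoAt (stalkHom p (sheafHomPre (freeCounit qᶜ (sheafHom F L)) L))]
      exact h₃ i

end Dualizing

/-! ### Dévissage -/

section Devissage

variable {k : Type u} [CommRing k] {n : ℕ} {W : CochainComplex (ModuleCat.{u} k) ℤ → Prop}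
  {L : CochainComplex (Shv k (Affine n)) ℤ}

lemma IsReflexive.of_acyclic (hW : IsStableClass W) (hL : IsDualizing L)
    {F : CochainComplex (Shv k (Affine n)) ℤ} (hF : F.Acyclic) : IsReflexive W L F := by
  have h := hL.acyclic_stalk_sheafHom_of_acyclic hF
  exact ⟨fun p => hW.of_acyclic (h p), quasiIso_of_acyclic _ hF ((acyclic_iff_stalk _).2
    (hL.acyclic_stalk_sheafHom_of_acyclic ((acyclic_iff_stalk _).2 h)))⟩

lemma IsReflexive.prop_X₁ (hW : IsStableClass W) (hL : IsDualizing L)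
    {S : ShortComplex (CochainComplex (Shv k (Affine n)) ℤ)} (hS : S.ShortExact)
    (h₂ : IsReflexive W L S.X₂) (h₃ : IsReflexive W L S.X₃) : IsReflexive W L S.X₁ := by
  have hS' := sheafHom_shortExact hS L hL.injective
  exact ⟨fun p => hW.prop_X₃ (shortExact_map_mapHomologicalComplex
      ((evaluation _ (ModuleCat.{u} k)).obj p) hS') (h₃.1 p) (h₂.1 p),
    quasiIso_τ₁ (bidualityShortComplex S L) hS (sheafHom_shortExact hS' L hL.injective) h₂.2 h₃.2⟩

/-- The short exact sequence of stalks of a mapping cone. -/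
lemma stalk_mappingCone_shortExact {X : Type} [PartialOrder X]
    {F G : CochainComplex (Shv k X) ℤ} (f : F ⟶ G) (p : X) :
    ((CochainComplex.mappingCone.triangleRotateShortComplex f).map (stalkFunctor p)).ShortExact :=
  shortExact_map_mapHomologicalComplex _ (mappingCone_shortExact f)

lemma acyclic_stalk_mappingCone {X : Type} [PartialOrder X]
    {F G : CochainComplex (Shv k X) ℤ} (f : F ⟶ G) (p : X) [QuasiIso (stalkHom p f)] :
    (stalk p (CochainComplex.mappingCone f)).Acyclic := fun i => by
  rw [exactAt_iff_of_quasiIsoAt (CochainComplex.mappingCone.mapHomologicalComplexIso f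
    ((evaluation X (ModuleCat.{u} k)).obj p)).hom]
  exact mappingCone_acyclic (stalkHom p f) i

lemma acyclic_X₂ {C : Type*} [Category* C] [Abelian C] {S : ShortComplex (CochainComplex C ℤ)}
    (hS : S.ShortExact) (h₁ : S.X₁.Acyclic) (h₃ : S.X₃.Acyclic) : S.X₂.Acyclic := fun i => by
  rw [HomologicalComplex.exactAt_iff_isZero_homology]
  exact (hS.homology_exact₂ i).isZero_X₂ ((h₁ i).isZero_homology.eq_of_src _ _)
    ((h₃ i).isZero_homology.eq_of_tgt _ _)

/-- A complex whose stalks belong to a class of reflexive complexes of modules is reflexive. The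
induction is on an upper set `S` outside of which `F` is acyclic: at a minimal point `p` of `S`, the
cone of the counit from the free sheaf on `U_p` with stalk `F_p` is acyclic at `p`. -/
theorem isReflexive_of_acyclic_off (hW : IsStableClass W) (hL : IsDualizing L)
    (hWL : ∀ E, W E → W (homCx k E (stalk Finset.univ L)) ∧
      QuasiIso (ev E (stalk Finset.univ L)))
    (S : Finset (Affine n)) (hS : IsUpperSet (S : Set (Affine n)))
    (F : CochainComplex (Shv k (Affine n)) ℤ) (hF : ∀ p, W (stalk p F))
    (hFS : ∀ p, p ∉ S → (stalk p F).Acyclic) : IsReflexive W L F := by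
  induction S using Finset.strongInduction generalizing F with
  | H S ih =>
    obtain rfl | hne := S.eq_empty_or_nonempty
    · exact .of_acyclic hW hL ((acyclic_iff_stalk F).2 fun p => hFS p (Finset.notMem_empty p))
    obtain ⟨p, hp⟩ := S.exists_minimal hne
    let A := freeCx p (stalk p F)
    have hA : IsFree p A := isFree_freeCx p (stalk p F)
    have hε : IsIso (stalkHom p (freeCounit p F)) := isIso_stalkHom_freeCounit p F
    have hG : IsFree p (A⟦(1 : ℤ)⟧) := hA.shift 1
    have hA₁ : W (stalk p A) := (hW.iff_of_quasiIso (stalkHom p (freeCounit p F)) inferInstance).2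
      (hF p)
    -- The cone of the identity of `A` is acyclic and an extension of `A⟦1⟧` by `A`.
    have hG₁ : W (stalk p (A⟦(1 : ℤ)⟧)) :=
      hW.prop_X₃ (stalk_mappingCone_shortExact (𝟙 A) p) hA₁
        (hW.of_acyclic (acyclic_mapHomologicalComplex _ (mappingCone_acyclic (𝟙 A))))
    have hG₂ (s : Affine n) : W (stalk s (A⟦(1 : ℤ)⟧)) := by
      by_cases h : p ≤ s
      · have := hG.isIso_stalkRes le_rfl h
        exact (hW.iff_of_quasiIso (stalkRes _ h) inferInstance).1 hG₁
      · exact hW.of_acyclic (hG.acyclic_stalk h)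
    have hC := mappingCone_shortExact (freeCounit p F)
    refine .prop_X₁ hW hL hC ?_ ?_
    · -- The cone is acyclic outside of the upper set `S \ {p}`.
      refine ih (S.erase p) (Finset.erase_ssubset hp.1) ?_ _ (fun s => ?_) (fun s hs => ?_)
      · intro s t hst hs
        rw [Finset.mem_coe, Finset.mem_erase] at hs ⊢
        refine ⟨?_, hS hst hs.2⟩
        rintro rfl
        exact hs.1 (le_antisymm hst (hp.2 hs.2 hst))
      · exact hW.prop_X₂ (stalk_mappingCone_shortExact (freeCounit p F) s) (hF s) (hG₂ s)
      · by_cases hsp : s = p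
        · subst hsp
          exact acyclic_stalk_mappingCone _ _
        · have hsS : s ∉ S := fun h => hs (Finset.mem_erase.2 ⟨hsp, h⟩)
          exact acyclic_X₂ (stalk_mappingCone_shortExact (freeCounit p F) s) (hFS s hsS)
            (hG.acyclic_stalk fun h => hsS (hS h hp.1))
    · have h := hWL _ (hG₂ Finset.univ)
      exact hL.isReflexive_of_isFree hW hG h.1 h.2

end Devissage

/-! ### The dualizing complex -/

section Omega

variable {k : Type u} [CommRing k] {n : ℕ} (I : InjectiveResolution (omega k n))

lemma isZero_omega_obj {p : Affine n} (hp : p ≠ Finset.univ) : IsZero ((omega k n).obj p) := by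
  refine ModuleCat.isZero_iff_subsingleton.2 ?_
  change Subsingleton (if p = Finset.univ then ⊤ else ⊥ : Submodule k k)
  rw [if_neg hp]
  infer_instance

/-- The stalk of `ω` at the open point. -/
def omegaObjUnivIso : (omega k n).obj Finset.univ ≅ ModuleCat.of k k :=
  LinearEquiv.toModuleIso (LinearEquiv.ofTop _ (if_pos rfl))

instance quasiIso_stalkHom_ι' (p : Affine n) : QuasiIso (stalkHom p I.ι') :=
  (quasiIso_iff_stalkHom _).1 inferInstance p

lemma isZero_stalk_single_X (p : Affine n) (i : ℤ) (h : i ≠ 0 ∨ p ≠ Finset.univ) :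
    IsZero ((stalk p ((CochainComplex.singleFunctor _ 0).obj (omega k n))).X i) := by
  by_cases hi : i = 0
  · subst hi
    exact (isZero_omega_obj (h.resolve_left fun h => h rfl)).of_iso
      (((evaluation _ (ModuleCat.{u} k)).obj p).mapIso
        (HomologicalComplex.singleObjXSelf (ComplexShape.up ℤ) 0 (omega k n)))
  · exact ((evaluation _ (ModuleCat.{u} k)).obj p).map_isZero
      (HomologicalComplex.isZero_single_obj_X (ComplexShape.up ℤ) 0 (omega k n) i hi)

lemma isDualizing_cochainComplex : IsDualizing I.cochainComplex where
  isStrictlyGE := inferInstance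
  injective := inferInstance
  acyclic p hp i := by
    rw [← exactAt_iff_of_quasiIsoAt (stalkHom p I.ι'), HomologicalComplex.exactAt_iff]
    exact ShortComplex.exact_of_isZero_X₂ _ (isZero_stalk_single_X p i (.inr hp))

/-- The term of degree zero of the stalk at the open point of `ω`, as a complex. -/
def stalkSingleXIso :
    (stalk Finset.univ ((CochainComplex.singleFunctor _ 0).obj (omega k n))).X 0 ≅
      ModuleCat.of k k :=
  ((evaluation _ (ModuleCat.{u} k)).obj Finset.univ).mapIso
    (HomologicalComplex.singleObjXSelf (ComplexShape.up ℤ) 0 (omega k n)) ≪≫ omegaObjUnivIso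

lemma isReflexive_of_stalk {W : CochainComplex (ModuleCat.{u} k) ℤ → Prop} (hW : IsStableClass W)
    (hWL : ∀ E, W E → W (homCx k E (stalk Finset.univ I.cochainComplex)) ∧
      QuasiIso (ev E (stalk Finset.univ I.cochainComplex)))
    {F : CochainComplex (Shv k (Affine n)) ℤ} (hF : ∀ p, W (stalk p F)) :
    IsReflexive W I.cochainComplex F :=
  isReflexive_of_acyclic_off hW (isDualizing_cochainComplex I) hWL Finset.univ
    (fun _ _ _ _ => by simp) F hF fun p hp => (hp (Finset.mem_univ p)).elim

lemma isReflexive_of_isPointwisePerfect {F : CochainComplex (Shv k (Affine n)) ℤ}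
    (hF : IsPointwisePerfect F) : IsReflexive IsPerfect I.cochainComplex F := by
  have := (isDualizing_cochainComplex I).isKInjective_stalk Finset.univ
  exact isReflexive_of_stalk I isPerfect_isStableClass
    (fun E hE => isPerfect_dual (fun i hi => isZero_stalk_single_X _ i (.inl hi)) stalkSingleXIso
      (stalkHom Finset.univ I.ι') hE) hF

lemma isReflexive_of_hasFGHomology (hk : IsGorensteinRing k) (hd : ringKrullDim k ≠ ⊤)
    {F : CochainComplex (Shv k (Affine n)) ℤ} (hF : ∀ p, HasFGHomology (stalk p F)) :
    IsReflexive HasFGHomology I.cochainComplex F := by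
  have := hk.1
  obtain ⟨N, _⟩ := exists_hasInjectiveDimensionLE hk hd
  have h₀ (i : ℤ) (hi : i ≠ 0) := isZero_stalk_single_X (k := k) (n := n) Finset.univ i (.inl hi)
  have hJ (i : ℤ) : Injective ((stalk Finset.univ I.cochainComplex).X i) :=
    injective_obj (I.cochainComplex.X i) Finset.univ
  exact isReflexive_of_stalk I hasFGHomology_isStableClass (fun E hE =>
    ⟨hasFGHomology_homCx h₀ stalkSingleXIso (stalkHom Finset.univ I.ι') hJ N hE,
      quasiIso_ev_of_hasFGHomology h₀ stalkSingleXIso (stalkHom Finset.univ I.ι') hJ N hE⟩) hF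

end Omega

lemma hasFGCohomology_iff {k : Type u} [CommRing k] {X : Type} [PartialOrder X]
    (F : CochainComplex (Shv k X) ℤ) : HasFGCohomology F ↔ ∀ p, HasFGHomology (stalk p F) := by
  have e (i : ℤ) (p : X) : (F.homology i).obj p ≃ₗ[k] (stalk p F).homology i :=
    (((F.sc i).mapHomologyIso ((evaluation X (ModuleCat.{u} k)).obj p)).symm).toLinearEquiv
  exact ⟨fun h p i => have := h i p; Module.Finite.equiv (e i p),
    fun h i p => have := h p i; Module.Finite.equiv (e i p).symm⟩

end F1

end

theorem mainTheorem8 {k : Type u} [CommRing k] (n : ℕ)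
    [HasDerivedCategory.{w} (F1.Shv k (F1.Affine n))]
    (I : InjectiveResolution (F1.omega k n)) :
    (∀ F : CochainComplex (F1.Shv k (F1.Affine n)) ℤ, F1.IsPointwisePerfect F →
      F1.IsPointwisePerfect (F1.dual I F) ∧
        IsIso (DerivedCategory.Q.map (F1.toBidual I F))) ∧
    (F1.IsGorensteinRing k → ringKrullDim k ≠ ⊤ →
      ∀ F : CochainComplex (F1.Shv k (F1.Affine n)) ℤ, F1.HasFGCohomology F →
        F1.HasFGCohomology (F1.dual I F) ∧
          IsIso (DerivedCategory.Q.map (F1.toBidual I F))) := by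
  simp only [DerivedCategory.isIso_Q_map_iff_quasiIso]
  refine ⟨fun F hF => F1.isReflexive_of_isPointwisePerfect I hF, fun hk hd F hF => ?_⟩
  rw [F1.hasFGCohomology_iff] at hF ⊢
  exact F1.isReflexive_of_hasFGHomology I hk hd hF
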